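/- Let $p$ be a prime, $e\ge 2$, and let $j$ be the smallest positive integer with $e\mid p^j+1$ (assumed to exist). Let $q=p^{2j\gamma}$ with $\gamma\ge 1$, let $g$ be a primitive element of $\mathbb F_q$, put $f=(q-1)/e$, and let $C_i=\{g^{i+el}\mid 0\le l\le f-1\}$, $0\le i\le e-1$, be the cyclotomic classes of $\mathbb F_q$ of order $e$. Let $n=2m$ be an even positive integer, $V=\mathbb F_q^n$, and let $Q:V\to\mathbb F_q$ be a nonsingular quadratic form, i.e. with $B(v,w)=Q(v+w)-Q(v)-Q(w)$ the only $w\in V$ with $Q(w)=0$ and $B(w,v)=0$ for all $v\in V$ is $w=0$. Put $D_0=\{x\in V\mid Q(x)=0\}$ and $D_{C_i}=\{x\in V\mid Q(x)\in C_i\}$. For $D\subseteq V$ let $\mathrm{Cay}(V,D)$ be the graph on $V$ in which $x,y$ are adjacent if and only if $x-y\in D$. A $d$-class symmetric association scheme on a finite set $V$ is a partition of $V\times V$ into nonempty symmetric relations $R_0,\dots,R_d$ with $R_0=\{(x,x)\mid x\in V\}$ such that for all $i,j,k\in\{0,\dots,d\}$ there is an integer $p_{ij}^k$ with $|\{z\in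 V\mid (x,z)\in R_i,\ (z,y)\in R_j\}|=p_{ij}^k$ for all $(x,y)\in R_k$; its graphs are those with edge sets $R_1,\dots,R_d$. It is amorphic if each of its fusions (obtained by merging the relations $R_1,\dots,R_d$ according to an arbitrary partition of $\{1,\dots,d\}$, and keeping $R_0$) is again a symmetric association scheme. Then, unless $m=1$ and $Q$ is elliptic (that is, $m=1$ and $Q$ has no nonzero zero), the Cayley graphs $\mathrm{Cay}(V,D_0\setminus\{0\})$ and $\mathrm{Cay}(V,D_{C_i})$, $0\le i\le e-1$, are the graphs of an $(e+1)$-class amorphic association scheme on $V$. If $m=1$ and $Q$ is elliptic, then $D_0\setminus\{0\}=\emptyset$ and the graphs $\mathrm{Cay}(V,D_{C_i})$, $0\le i\le e-1$, are the graphs of an $e$-class amorphic association scheme on $V$. -/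

import Mathlib

namespace QuadraticCyclotomy

/-- `IsSymmetricAssociationScheme d R`: the sets `R 0, R 1, …, R d` are the relations of a `d`-class
symmetric association scheme on the finite set `V`. -/
structure IsSymmetricAssociationScheme {V : Type*} [Finite V] (d : ℕ)
    (R : Fin (d + 1) → Set (V × V)) : Prop where
  /-- the parts of the partition are nonempty -/
  nonempty : ∀ i, (R i).Nonempty
  /-- every pair lies in exactly one part -/
  existsUnique_mem : ∀ a : V × V, ∃! i, a ∈ R i
  /-- `R 0` is the diagonal -/
  diagonal : R 0 = Set.diagonal V
  /-- every relation is symmetric -/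
  symmetric : ∀ i x y, (x, y) ∈ R i → (y, x) ∈ R i
  /-- the intersection numbers exist -/
  intersection_numbers : ∀ i j k, ∃ c : ℕ, ∀ x y, (x, y) ∈ R k →
    {z : V | (x, z) ∈ R i ∧ (z, y) ∈ R j}.ncard = c

/-- The family of relations obtained from `R` by merging all relations whose indices have the
same image under `π`. -/
def fusion {V : Type*} {d d' : ℕ} (π : Fin (d + 1) → Fin (d' + 1))
    (R : Fin (d + 1) → Set (V × V)) : Fin (d' + 1) → Set (V × V) :=
  fun k => ⋃ i ∈ {i | π i = k}, R i

/-- An amorphic association scheme: every fusion is again an association scheme. A fusion merges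
nondiagonal relations, so it is given by a surjection `π` of index sets under which only the index
`0` goes to `0`. -/
def IsAmorphicAssociationScheme {V : Type*} [Finite V] (d : ℕ)
    (R : Fin (d + 1) → Set (V × V)) : Prop :=
  IsSymmetricAssociationScheme d R ∧
    ∀ (d' : ℕ) (π : Fin (d + 1) → Fin (d' + 1)), Function.Surjective π →
      (∀ i, π i = 0 ↔ i = 0) → IsSymmetricAssociationScheme d' (fusion π R)

/-- The (directed) edge sets `G 0, …, G (d - 1)` on `V` are the graphs of a `d`-class amorphic
association scheme on `V`: together with the diagonal they are the relations of such a scheme. -/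
def FormAmorphicAssociationScheme {V : Type*} [Finite V] {d : ℕ}
    (G : Fin d → Set (V × V)) : Prop :=
  IsAmorphicAssociationScheme d
    (Fin.cons (α := fun _ => Set (V × V)) (Set.diagonal V) G)

/-- The edge set of the Cayley graph `Cay(G, D)` of an additive group: `x` and `y` are adjacent
if and only if `x - y ∈ D`. -/
def cayleyEdges {G : Type*} [AddGroup G] (D : Set G) : Set (G × G) :=
  {a | a.1 - a.2 ∈ D}

/-- The cyclotomic class `C_i = {g ^ (i + e l) | 0 ≤ l ≤ f - 1}`, with `f = (q - 1) / e`, of order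
`e` of a finite field with `q` elements and primitive element `g`. -/
def cyclotomicClass {F : Type*} [Field F] (g : Fˣ) (e i : ℕ) : Set F :=
  {y | ∃ l < (Nat.card F - 1) / e, y = (g : F) ^ (i + e * l)}

end QuadraticCyclotomy

/-! Let `B` be the polar form of `Q` and fix a primitive additive character `ψ` of the field. The
classes are studied through the characters `x ↦ ψ (B (x, w))`, which are orthogonal because `B` is
nondegenerate. The scheme rests on a duality: there are constants `M` and `ρ i` such that, for `w ≠
0`, the transform of class `i` plus `ρ i` is `M` times the indicator of a dual set, and the dual
sets are disjoint. So the shifted transforms multiply like orthogonal idempotents scaled by `M`.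
Inverting, the convolution of two classes is a combination of classes, the delta function at `0` and
a constant, which gives the intersection numbers. Merging classes adds their transforms, so the same
relation survives every fusion. This is `formAmorphicAssociationScheme_of_dual`.

For the transforms, even dimension makes `M = ∑ ψ (t Q x)` independent of `t ≠ 0`. Completing the
square, `q` times the transform of `Q = c` at `w` is `M ∑ ψ (-Q w / t - t c)` over `t ≠ 0`. Summed
over `c` in a cyclotomic class, the second factor becomes a Gaussian period. If the periods are
uniform (two-valued), it is affine in the indicator of a coset, so the sum over `t` is again a
period. The dual set is then given by `Q w` lying in the inverse class (`card_mul_sum_cyclotomic`).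

Uniformity (`exists_hasUniformPeriods`) is an induction on `γ`, with `r = √q = p ^ (j γ)`. For odd
`γ`, `e` divides `r + 1`, the nonzero elements of the subfield of order `r` lie in the group `x ^ f
= 1`, and averaging over the subfield gives sign `δ = 1`. For even `γ`, the subfield satisfies the
induction hypothesis for `γ / 2`; the norm is an anisotropic binary form over it, and
`card_mul_sum_cyclotomic` applied to the norm gives `δ = -1`. -/

namespace QuadraticCyclotomy

open Finset

/-- A translation-invariant partition, given by a class function `κ` on the group, is a symmetric
association scheme as soon as the convolution counts of its classes are class functions. -/
theorem isSymmetricAssociationScheme_of_classFunction {V : Type*} [AddCommGroup V] [Finite V]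
    {d : ℕ} (κ : V → Fin (d + 1)) (hsurj : Function.Surjective κ) (hzero : ∀ x, κ x = 0 ↔ x = 0)
    (hneg : ∀ x, κ (-x) = κ x)
    (hcount : ∀ i j x y, κ x = κ y →
      {z | κ z = i ∧ κ (x - z) = j}.ncard = {z | κ z = i ∧ κ (y - z) = j}.ncard) :
    IsSymmetricAssociationScheme d (fun i => {a : V × V | κ (a.1 - a.2) = i}) where
  nonempty i := by
    obtain ⟨x, hx⟩ := hsurj i
    exact ⟨(x, 0), by simpa using hx⟩
  existsUnique_mem a := ⟨κ (a.1 - a.2), rfl, fun _ h => h.symm⟩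
  diagonal := by
    ext ⟨x, y⟩
    simp [hzero, sub_eq_zero]
  symmetric i x y h := by
    simp only [Set.mem_ofPred_eq] at h ⊢
    rw [← h, ← hneg, neg_sub]
  intersection_numbers i j k := by
    obtain ⟨t, ht⟩ := hsurj k
    refine ⟨{z | κ z = i ∧ κ (t - z) = j}.ncard, fun x y hxy => ?_⟩
    rw [← hcount i j (x - y) t (hxy.trans ht.symm)]
    refine Set.ncard_congr (fun z _ => x - z) ?_ ?_ ?_
    · rintro z ⟨h1, h2⟩
      refine ⟨h1, ?_⟩
      rw [← h2]
      simp
    · intro a b _ _ h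
      simpa using h
    · rintro z ⟨h1, h2⟩
      refine ⟨x - z, ⟨by simpa using h1, ?_⟩, by simp⟩
      change κ (x - z - y) = j
      rw [sub_right_comm]
      exact h2

/-! ### Fourier criterion for amorphic schemes -/

section Fourier

variable {V : Type*} [AddCommGroup V] [Fintype V]

/-- Characters `χ w`, indexed by `w : V`, satisfying both orthogonality relations. -/
structure IsOrthogonal (χ : V → AddChar V ℂ) : Prop where
  sum_apply : ∀ w, w ≠ 0 → ∑ x, χ w x = 0
  sum_index : ∀ x, x ≠ 0 → ∑ w, χ w x = 0
  zero_apply : ∀ x, χ 0 x = 1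
  index_zero : ∀ w, χ w 0 = 1

/-- Fourier inversion: only the trivial character `χ 0` contributes, so the inverted value does not
depend on the point. -/
theorem IsOrthogonal.eq_of_hat_eq_zero {χ : V → AddChar V ℂ} (hχ : IsOrthogonal χ) (f : V → ℂ)
    (hf : ∀ w, w ≠ 0 → ∑ x, f x * χ w x = 0) (y z : V) : f y = f z := by
  classical
  have key : ∀ y, ∑ x, f x = Fintype.card V * f y := by
    intro y
    have h1 : ∑ w, (∑ x, f x * χ w x) * χ w (-y) = ∑ x, f x := by
      rw [Finset.sum_eq_single 0]
      · simp [hχ.zero_apply]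
      · intro w _ hw
        rw [hf w hw, zero_mul]
      · simp
    rw [← h1]
    simp_rw [Finset.sum_mul]
    rw [Finset.sum_comm]
    rw [Finset.sum_eq_single y]
    · simp_rw [mul_assoc, ← AddChar.map_add_eq_mul]
      simp [hχ.index_zero, mul_comm]
    · intro x _ hx
      simp_rw [mul_assoc, ← AddChar.map_add_eq_mul, ← Finset.mul_sum]
      rw [hχ.sum_index _ (by rwa [← sub_eq_add_neg, sub_ne_zero]), mul_zero]
    · simp
  have h0 : (Fintype.card V : ℂ) ≠ 0 := by
    exact_mod_cast Fintype.card_ne_zero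
  exact mul_left_cancel₀ h0 ((key y).symm.trans (key z))

theorem sum_convolution_mul_addChar (f g : V → ℂ) (χ : AddChar V ℂ) :
    ∑ x, (∑ z, f z * g (x - z)) * χ x = (∑ x, f x * χ x) * ∑ x, g x * χ x := by
  simp_rw [Finset.sum_mul]
  rw [Finset.sum_comm]
  refine Finset.sum_congr rfl fun z _ => ?_
  rw [Finset.mul_sum]
  refine (Fintype.sum_equiv (Equiv.addRight z) _ _ fun x => ?_).symm
  simp only [Equiv.coe_addRight, add_sub_cancel_right, AddChar.map_add_eq_mul]
  ring

/-- The transform of the indicator function of the class `i` of `κ`. -/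
noncomputable def classTransform {ι : Type*} [DecidableEq ι] (κ : V → ι) (χ : V → AddChar V ℂ)
    (i : ι) (w : V) : ℂ :=
  ∑ x, (if κ x = i then 1 else 0) * χ w x

/-- If, up to shifts, the transforms of the nonzero classes are orthogonal idempotents scaled
by `M`, then the classes form an association scheme. -/
theorem isSymmetricAssociationScheme_of_classTransform {d : ℕ} (κ : V → Fin (d + 1))
    (hsurj : Function.Surjective κ) (hzero : ∀ x, κ x = 0 ↔ x = 0) (hneg : ∀ x, κ (-x) = κ x)
    {χ : V → AddChar V ℂ} (hχ : IsOrthogonal χ) (ρ : Fin (d + 1) → ℂ) (M : ℂ)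
    (h : ∀ w, w ≠ 0 → ∀ i j, i ≠ 0 → j ≠ 0 →
      (classTransform κ χ i w + ρ i) * (classTransform κ χ j w + ρ j) =
        if i = j then M * (classTransform κ χ i w + ρ i) else 0) :
    IsSymmetricAssociationScheme d (fun i => {a : V × V | κ (a.1 - a.2) = i}) := by
  classical
  refine isSymmetricAssociationScheme_of_classFunction κ hsurj hzero hneg ?_
  intro i j x y hxy
  have hx0 : x = 0 ↔ y = 0 := by rw [← hzero, ← hzero, hxy]
  by_cases hi : i = 0
  · subst hi
    have : ∀ t, {z | κ z = 0 ∧ κ (t - z) = j} = {z | z = 0 ∧ κ t = j} := by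
      intro t
      ext z
      simp only [hzero, Set.mem_ofPred_eq]
      refine and_congr_right fun hz => by rw [hz, sub_zero]
    rw [this, this, hxy]
  by_cases hj : j = 0
  · subst hj
    have : ∀ t, {z | κ z = i ∧ κ (t - z) = 0}.ncard = if κ t = i then 1 else 0 := by
      intro t
      simp only [hzero, sub_eq_zero]
      split_ifs with ht
      · rw [Set.ncard_eq_one]
        refine ⟨t, ?_⟩
        ext z
        simp only [Set.mem_ofPred_eq, Set.mem_singleton_iff]
        exact ⟨fun h => h.2.symm, fun h => by simp [h, ht]⟩
      · rw [Set.ncard_eq_zero]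
        ext z
        simp only [Set.mem_ofPred_eq, Set.mem_empty_iff_false, iff_false]
        rintro ⟨h1, rfl⟩
        exact ht h1
    rw [this, this, hxy]
  let I : Fin (d + 1) → V → ℂ := fun i x => if κ x = i then 1 else 0
  have hcard : ∀ t, ((({z | κ z = i ∧ κ (t - z) = j}.ncard : ℕ)) : ℂ) =
      ∑ z, I i z * I j (t - z) := by
    intro t
    rw [Set.ncard_eq_toFinset_card']
    simp only [I, ← ite_and, mul_ite, mul_one, mul_zero, Set.toFinset_ofPred]
    rw [Finset.sum_boole]
    congr 2
    ext z
    simp [and_comm]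
  -- Expanding the hypothesis, the product of the two transforms is `s - ρ j` times the first, minus
  -- `ρ i` times the second, plus the constant `c`. The delta function has transform `1` and absorbs
  -- `c`.
  let δ : V → ℂ := fun x => if x = 0 then 1 else 0
  let c : ℂ := (if i = j then M else 0) * ρ i - ρ i * ρ j
  let s : ℂ := if i = j then M else 0
  have hconst := hχ.eq_of_hat_eq_zero
    (fun x => (∑ z, I i z * I j (x - z)) - (s - ρ j) * I i x + ρ i * I j x - c * δ x) (by
      intro w hw
      have hδ : ∑ x, δ x * χ w x = 1 := by simp [δ, hχ.index_zero]
      have e : ∀ x, ((∑ z, I i z * I j (x - z)) - (s - ρ j) * I i x + ρ i * I j x - c * δ x) * χ w x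
          = (∑ z, I i z * I j (x - z)) * χ w x - (s - ρ j) * (I i x * χ w x)
            + ρ i * (I j x * χ w x) - c * (δ x * χ w x) := fun x => by ring
      simp_rw [e]
      rw [Finset.sum_sub_distrib, Finset.sum_add_distrib, Finset.sum_sub_distrib,
        ← Finset.mul_sum, ← Finset.mul_sum, ← Finset.mul_sum, hδ, sum_convolution_mul_addChar]
      have := h w hw i j hi hj
      change (∑ x, I i x * χ w x + ρ i) * (∑ x, I j x * χ w x + ρ j) =
        if i = j then M * (∑ x, I i x * χ w x + ρ i) else 0 at this
      have h2 : (if i = j then M * (∑ x, I i x * χ w x + ρ i) else 0) =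
        s * (∑ x, I i x * χ w x + ρ i) := by
        simp only [s]; split_ifs <;> simp
      rw [h2] at this
      simp only [c]
      linear_combination this)
    x y
  have hI : ∀ i, I i x = I i y := fun i => by simp only [I, hxy]
  have hδ : δ x = δ y := by simp only [δ, hx0]
  simp only [hI, hδ] at hconst
  have : ((({z | κ z = i ∧ κ (x - z) = j}.ncard : ℕ)) : ℂ) =
      ({z | κ z = i ∧ κ (y - z) = j}.ncard : ℕ) := by
    rw [hcard, hcard]
    linear_combination hconst
  exact_mod_cast this

theorem classTransform_comp {ι ι' : Type*} [Fintype ι] [DecidableEq ι] [DecidableEq ι']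
    (κ : V → ι) (π : ι → ι') (χ : V → AddChar V ℂ) (k : ι') (w : V) :
    classTransform (π ∘ κ) χ k w = ∑ i with π i = k, classTransform κ χ i w := by
  unfold classTransform
  rw [Finset.sum_comm]
  refine Finset.sum_congr rfl fun x _ => ?_
  rw [← Finset.sum_mul]
  congr 1
  simp [Finset.sum_ite_eq]

/-- A partition of `V ∖ {0}` whose classes have, up to shifts, transforms that are orthogonal
idempotents scaled by `M` gives an amorphic association scheme. -/
theorem formAmorphicAssociationScheme_of_transform [DecidableEq V] {d : ℕ} (A : Fin d → Set V)
    [∀ i, DecidablePred (· ∈ A i)]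
    (hne : ∀ i, (A i).Nonempty) (hdisj : ∀ i j x, x ∈ A i → x ∈ A j → i = j)
    (hzero : ∀ i, (0 : V) ∉ A i) (hcover : ∀ x, x ≠ 0 → ∃ i, x ∈ A i)
    (hneg : ∀ i x, x ∈ A i → -x ∈ A i)
    {χ : V → AddChar V ℂ} (hχ : IsOrthogonal χ) (ρ : Fin d → ℂ) (M : ℂ)
    (h : ∀ w, w ≠ 0 → ∀ i j,
      (∑ x, (if x ∈ A i then 1 else 0) * χ w x + ρ i) *
        (∑ x, (if x ∈ A j then 1 else 0) * χ w x + ρ j) =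
        if i = j then M * (∑ x, (if x ∈ A i then 1 else 0) * χ w x + ρ i) else 0) :
    FormAmorphicAssociationScheme (fun i => cayleyEdges (A i)) := by
  choose c hc using hcover
  let κ : V → Fin (d + 1) := fun x => if hx : x = 0 then 0 else (c x hx).succ
  have κ0 : ∀ x, κ x = 0 ↔ x = 0 := by
    intro x
    simp only [κ]
    split_ifs with hx <;> simp [hx]
  have κs : ∀ x i, κ x = Fin.succ i ↔ x ∈ A i := by
    intro x i
    simp only [κ]
    split_ifs with hx
    · subst hx
      simp [hzero, (Fin.succ_ne_zero i).symm]
    · rw [Fin.succ_inj]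
      exact ⟨fun h => h ▸ hc x hx, fun h => hdisj _ _ x (hc x hx) h⟩
  have κneg : ∀ x, κ (-x) = κ x := by
    intro x
    by_cases hx : x = 0
    · simp [hx]
    · have : κ x = Fin.succ (c x hx) := dif_neg hx
      rw [this, κs]
      exact hneg _ _ (hc x hx)
  have κsurj : Function.Surjective κ := by
    intro i
    refine Fin.cases ⟨0, (κ0 0).2 rfl⟩ (fun i => ?_) i
    obtain ⟨x, hx⟩ := hne i
    exact ⟨x, (κs x i).2 hx⟩
  -- The shift at index `0` is arbitrary: only nonzero indices are ever used.
  let ρ' : Fin (d + 1) → ℂ := Fin.cons 0 ρ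
  have hT : ∀ w, w ≠ 0 → ∀ i j, i ≠ 0 → j ≠ 0 →
      (classTransform κ χ i w + ρ' i) * (classTransform κ χ j w + ρ' j) =
        if i = j then M * (classTransform κ χ i w + ρ' i) else 0 := by
    intro w hw i j hi hj
    obtain ⟨i, rfl⟩ := Fin.exists_succ_eq.2 hi
    obtain ⟨j, rfl⟩ := Fin.exists_succ_eq.2 hj
    simpa [classTransform, κs, ρ'] using h w hw i j
  have hR : (Fin.cons (α := fun _ => Set (V × V)) (Set.diagonal V) fun i => cayleyEdges (A i)) =
      fun i => {a : V × V | κ (a.1 - a.2) = i} := by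
    funext i
    refine Fin.cases ?_ (fun i => ?_) i
    · ext a
      simp [κ0, sub_eq_zero]
    · ext a
      simp [κs, cayleyEdges]
  unfold FormAmorphicAssociationScheme
  rw [hR]
  refine ⟨isSymmetricAssociationScheme_of_classTransform κ κsurj κ0 κneg hχ ρ' M hT, ?_⟩
  intro d' π hπ hπ0
  have hF : fusion π (fun i => {a : V × V | κ (a.1 - a.2) = i}) =
      fun k => {a : V × V | (π ∘ κ) (a.1 - a.2) = k} := by
    funext k
    ext a
    simp [fusion]
  rw [hF]
  refine isSymmetricAssociationScheme_of_classTransform (π ∘ κ) (hπ.comp κsurj)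
    (fun x => by simp [hπ0, κ0]) (fun x => by simp [κneg]) hχ
    (fun k => ∑ i with π i = k, ρ' i) M ?_
  intro w hw k l hk hl
  simp only [classTransform_comp, ← Finset.sum_add_distrib]
  have hne0 : ∀ k, k ≠ 0 → ∀ i, i ∈ (univ.filter fun i => π i = k) → i ≠ 0 := by
    intro k hk i hi h0
    rw [Finset.mem_filter] at hi
    exact hk (hi.2 ▸ (hπ0 i).2 h0)
  -- Products with distinct indices vanish, so only diagonal terms survive, and these occur only
  -- when `k = l`.
  rw [Finset.sum_mul_sum]
  rw [Finset.sum_congr rfl fun i hi => Finset.sum_congr rfl fun j hj =>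
    hT w hw i j (hne0 k hk i hi) (hne0 l hl j hj)]
  split_ifs with hkl
  · subst hkl
    rw [Finset.mul_sum]
    refine Finset.sum_congr rfl fun i hi => ?_
    rw [Finset.sum_ite_eq, if_pos hi]
  · refine Finset.sum_eq_zero fun i hi => Finset.sum_eq_zero fun j hj => if_neg ?_
    rintro rfl
    rw [Finset.mem_filter] at hi hj
    exact hkl (hi.2.symm.trans hj.2)

end Fourier

/-! ### Gaussian periods and transforms of the fibres of a quadratic form -/

section Periods

variable {K : Type*} [Field K] [Fintype K] [DecidableEq K]

/-- In a finite field with `e * f + 1` elements there are `f` solutions of `x ^ f = 1`. -/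
theorem card_pow_eq_one {e f : ℕ} (hef : e * f + 1 = Fintype.card K) :
    Finset.card {x : K | x ^ f = 1} = f := by
  have hpos : 0 < e * f := by have := Fintype.one_lt_card (α := K); omega
  have hf : 0 < f := Nat.pos_of_mul_pos_left hpos
  obtain ⟨g, hg⟩ := IsCyclic.exists_generator (α := Kˣ)
  have ho : orderOf g = e * f := by
    rw [orderOf_eq_card_of_forall_mem_zpowers hg, Nat.card_eq_fintype_card, Fintype.card_units]
    omega
  have h1 : IsPrimitiveRoot (g : K) (e * f) := by
    rw [IsPrimitiveRoot.coe_units_iff, ← ho]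
    exact IsPrimitiveRoot.orderOf g
  have h2 := (h1.pow hpos rfl).card_nthRootsFinset
  conv_rhs => rw [← h2]
  congr 1
  ext x
  simp [Polynomial.mem_nthRootsFinset hf]

/-- The Gaussian periods of the group `x ^ f = 1`, of index `e`, take only two values, and the
exceptional one is attained on the group itself. -/
def HasUniformPeriods (ψ : AddChar K ℂ) (e f : ℕ) (r δ : ℂ) : Prop :=
  ∀ t : K, t ≠ 0 → e * ∑ x, (if x ^ f = 1 then ψ (t * x) else 0) =
    δ * (r * e * (if t ^ f = 1 then 1 else 0) - (r + δ))

theorem HasUniformPeriods.sum_coset {ψ : AddChar K ℂ} {e f : ℕ} {r δ : ℂ}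
    (h : HasUniformPeriods ψ e f r δ) {a t : K} (ha : a ≠ 0) (ht : t ≠ 0) :
    e * ∑ c, (if c ^ f = a ^ f then ψ (t * c) else 0) =
      δ * (r * e * (if (t * a) ^ f = 1 then 1 else 0) - (r + δ)) := by
  rw [← h (t * a) (mul_ne_zero ht ha)]
  congr 1
  symm
  refine Fintype.sum_equiv (Equiv.mulLeft₀ a ha) _ _ fun x => ?_
  have : (a * x) ^ f = a ^ f ↔ x ^ f = 1 := by
    rw [mul_pow, mul_eq_left₀ (pow_ne_zero _ ha)]
  change _ = if (a * x) ^ f = a ^ f then ψ (t * (a * x)) else 0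
  simp only [this, mul_assoc]

theorem sum_addChar_mul {ψ : AddChar K ℂ} (hψ : ψ.IsPrimitive) (y : K) :
    ∑ t, ψ (t * y) = if y = 0 then (Fintype.card K : ℂ) else 0 := by
  rw [AddChar.sum_mulShift y hψ]
  split_ifs <;> simp

theorem sum_addChar_mul_ne_zero {ψ : AddChar K ℂ} (hψ : ψ.IsPrimitive) (y : K) :
    ∑ t, (if t = 0 then 0 else ψ (t * y)) = (if y = 0 then (Fintype.card K : ℂ) else 0) - 1 := by
  rw [← sum_addChar_mul hψ y, ← Finset.add_sum_erase _ _ (Finset.mem_univ (0 : K)),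
    ← Finset.add_sum_erase (a := (0 : K)) _ (fun t => ψ (t * y)) (Finset.mem_univ (0 : K))]
  simp only [if_true, zero_mul, AddChar.map_zero_eq_one, zero_add, add_sub_cancel_left]
  exact Finset.sum_congr rfl fun t ht => if_neg (Finset.ne_of_mem_erase ht)

theorem sum_addChar_neg_inv (F : K → ℂ) :
    ∑ t, (if t = 0 then 0 else F (-t⁻¹)) = ∑ s, if s = 0 then 0 else F s := by
  have : Function.Involutive fun t : K => -t⁻¹ := fun t => by simp [inv_neg]
  refine Fintype.sum_bijective _ this.bijective _ _ fun t => ?_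
  simp

variable {V : Type*} [AddCommGroup V] [Module K V] [Fintype V]

omit [Fintype K] [DecidableEq K] in
-- Completing the square: `t Q(x) + b(x, w) = t Q(x + t⁻¹ w) - t⁻¹ Q(w)`.
theorem sum_addChar_add_polar {ψ : AddChar K ℂ} {Q : V → K} {b : V → V → K} {M : ℂ}
    (hQ : ∀ x w s, Q (x + s • w) = Q x + s ^ 2 * Q w + s * b x w)
    (hS : ∀ t, t ≠ 0 → ∑ x, ψ (t * Q x) = M) (w : V) {t : K} (ht : t ≠ 0) :
    ∑ x, ψ (t * Q x + b x w) = ψ (-t⁻¹ * Q w) * M := by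
  rw [← hS t ht, Finset.mul_sum]
  refine Fintype.sum_equiv (Equiv.addRight (t⁻¹ • w)) _ _ fun x => ?_
  rw [← AddChar.map_add_eq_mul]
  congr 1
  simp only [Equiv.coe_addRight, hQ]
  field_simp
  ring

/-- The transform of the fibre of a quadratic form over `c`. -/
theorem card_mul_sum_fiber {ψ : AddChar K ℂ} (hψ : ψ.IsPrimitive) {Q : V → K} {b : V → V → K}
    {M : ℂ} (hQ : ∀ x w s, Q (x + s • w) = Q x + s ^ 2 * Q w + s * b x w)
    (hS : ∀ t, t ≠ 0 → ∑ x, ψ (t * Q x) = M) {w : V} (hb : ∑ x, ψ (b x w) = 0) (c : K) :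
    Fintype.card K * ∑ x, (if Q x = c then 1 else 0) * ψ (b x w) =
      M * ∑ t, (if t = 0 then 0 else ψ (-t⁻¹ * Q w) * ψ (-t * c)) := by
  have h1 : ∀ x, (Fintype.card K : ℂ) * ((if Q x = c then 1 else 0) * ψ (b x w)) =
      ∑ t, ψ (t * Q x + b x w) * ψ (-t * c) := by
    intro x
    have := sum_addChar_mul hψ (Q x - c)
    simp only [sub_eq_zero] at this
    rw [← mul_assoc, mul_ite, mul_one, mul_zero, ← this, Finset.sum_mul]
    refine Finset.sum_congr rfl fun t _ => ?_
    rw [← AddChar.map_add_eq_mul, ← AddChar.map_add_eq_mul]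
    congr 1
    ring
  rw [Finset.mul_sum, Finset.sum_congr rfl fun x _ => h1 x, Finset.sum_comm, Finset.mul_sum]
  refine Finset.sum_congr rfl fun t _ => ?_
  rw [← Finset.sum_mul]
  split_ifs with ht
  · subst ht
    simp [hb]
  · rw [sum_addChar_add_polar hQ hS w ht]
    ring

theorem card_mul_sum_fiber_zero {ψ : AddChar K ℂ} (hψ : ψ.IsPrimitive) {Q : V → K}
    {b : V → V → K} {M : ℂ} (hQ : ∀ x w s, Q (x + s • w) = Q x + s ^ 2 * Q w + s * b x w)
    (hS : ∀ t, t ≠ 0 → ∑ x, ψ (t * Q x) = M) {w : V} (hb : ∑ x, ψ (b x w) = 0) :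
    Fintype.card K * ∑ x, (if Q x = 0 then 1 else 0) * ψ (b x w) =
      M * ((if Q w = 0 then (Fintype.card K : ℂ) else 0) - 1) := by
  rw [card_mul_sum_fiber hψ hQ hS hb, ← sum_addChar_mul_ne_zero hψ,
    ← sum_addChar_neg_inv fun s => ψ (s * Q w)]
  simp

/-- The transform of the set of vectors with value in a cyclotomic class. -/
theorem card_mul_sum_cyclotomic {ψ : AddChar K ℂ} (hψ : ψ.IsPrimitive) {Q : V → K}
    {b : V → V → K} {M : ℂ} (hQ : ∀ x w s, Q (x + s • w) = Q x + s ^ 2 * Q w + s * b x w)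
    (hS : ∀ t, t ≠ 0 → ∑ x, ψ (t * Q x) = M) {w : V} (hb : ∑ x, ψ (b x w) = 0)
    {e f : ℕ} {r δ : ℂ} (hef : e * f + 1 = Fintype.card K) (hr : r ^ 2 = Fintype.card K)
    (hδ : δ ^ 2 = 1) (hneg : (-1 : K) ^ f = 1) (hper : HasUniformPeriods ψ e f r δ)
    {a : K} (ha : a ≠ 0) :
    Fintype.card K * (e * ∑ x, (if Q x ^ f = a ^ f then 1 else 0) * ψ (b x w)) =
      M * (Fintype.card K * e * (if (a * Q w) ^ f = 1 then 1 else 0) - (Fintype.card K - 1)) := by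
  have hf : f ≠ 0 := by
    rintro rfl
    have := Fintype.one_lt_card (α := K)
    omega
  have h1 : ∑ x, (if Q x ^ f = a ^ f then 1 else 0) * ψ (b x w) =
      ∑ c : K, (if c ^ f = a ^ f then (1 : ℂ) else 0) *
        ∑ x, (if Q x = c then 1 else 0) * ψ (b x w) := by
    simp_rw [Finset.mul_sum]
    rw [Finset.sum_comm]
    refine Finset.sum_congr rfl fun x _ => ?_
    rw [Finset.sum_eq_single (Q x)]
    · simp
    · intro c _ hc
      simp [Ne.symm hc]
    · simp
  have h2 : Fintype.card K * (e * ∑ x, (if Q x ^ f = a ^ f then 1 else 0) * ψ (b x w)) =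
      M * ∑ t : K, (if t = 0 then 0 else ψ (-t⁻¹ * Q w) *
        (e * ∑ c, if c ^ f = a ^ f then ψ (-t * c) else 0)) := by
    rw [h1, mul_left_comm, Finset.mul_sum]
    simp_rw [mul_left_comm (Fintype.card K : ℂ), card_mul_sum_fiber hψ hQ hS hb]
    simp_rw [Finset.mul_sum]
    rw [Finset.sum_comm]
    refine Finset.sum_congr rfl fun t _ => ?_
    split_ifs with ht
    · simp
    · rw [Finset.mul_sum]
      refine Finset.sum_congr rfl fun c _ => ?_
      split_ifs <;> ring
  -- The inner sum is a period at `-t`. As `(-1) ^ f = 1`, its exceptional condition on `-t` becomes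
  -- the coset condition `s ^ f = a ^ f` on `s = -t⁻¹`.
  have h3 : ∀ t : K, (if t = 0 then 0 else ψ (-t⁻¹ * Q w) *
        (e * ∑ c, if c ^ f = a ^ f then ψ (-t * c) else 0)) =
      if t = 0 then 0 else (fun s => ψ (s * Q w) *
        (δ * (r * e * (if s ^ f = a ^ f then 1 else 0) - (r + δ)))) (-t⁻¹) := by
    intro t
    split_ifs with ht
    · rfl
    · rw [hper.sum_coset ha (neg_ne_zero.2 ht)]
      have : (-t⁻¹) ^ f = a ^ f ↔ (-t * a) ^ f = 1 := by
        rw [neg_pow, hneg, one_mul, mul_pow, neg_pow, hneg, one_mul, inv_pow,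
          inv_eq_iff_eq_inv, mul_eq_one_iff_eq_inv₀ (pow_ne_zero _ ha)]
      simp only [this]
  rw [h2, Finset.sum_congr rfl fun t _ => h3 t, sum_addChar_neg_inv fun s =>
    ψ (s * Q w) * (δ * (r * e * (if s ^ f = a ^ f then 1 else 0) - (r + δ)))]
  -- The affine weight splits the sum into a second period, at `Q w`, and a complete character sum.
  have h4 : ∑ s : K, (if s = 0 then 0 else ψ (s * Q w) *
        (δ * (r * e * (if s ^ f = a ^ f then 1 else 0) - (r + δ)))) =
      δ * r * (e * ∑ s, if s ^ f = a ^ f then ψ (Q w * s) else 0) -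
        δ * (r + δ) * ∑ s, (if s = 0 then 0 else ψ (s * Q w)) := by
    simp_rw [Finset.mul_sum]
    rw [← Finset.sum_sub_distrib]
    refine Finset.sum_congr rfl fun s _ => ?_
    by_cases hs : s = 0
    · subst hs
      simp [hf, (pow_ne_zero f ha).symm]
    · simp only [hs, if_false, mul_comm (Q w)]
      split_ifs <;> ring
  rw [h4, sum_addChar_mul_ne_zero hψ]
  congr 1
  have hefC : (e : ℂ) * f + 1 = Fintype.card K := by exact_mod_cast hef
  rw [← hr] at hefC ⊢
  split_ifs with h0 h5 h5
  · rw [h0, mul_zero, zero_pow hf] at h5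
    exact absurd h5 zero_ne_one
  · have h6 : ∑ s : K, (if s ^ f = a ^ f then ψ (Q w * s) else 0) = f := by
      rw [h0]
      simp only [zero_mul, AddChar.map_zero_eq_one]
      rw [Finset.sum_boole]
      congr 1
      refine Eq.trans ?_ (card_pow_eq_one hef)
      symm
      refine Finset.card_equiv (Equiv.mulLeft₀ a ha) fun x => ?_
      simp [mul_pow, pow_ne_zero _ ha]
    rw [h6]
    linear_combination δ * r * hefC - (r ^ 2 - 1) * hδ
  · rw [hper.sum_coset ha h0, if_pos (by rwa [mul_comm])]
    linear_combination (r ^ 2 * e - r ^ 2 - δ * r + 1) * hδ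
  · rw [hper.sum_coset ha h0, if_neg (by rwa [mul_comm])]
    linear_combination (1 - r ^ 2 - δ * r) * hδ

end Periods

/-! ### The subfield of index two and the base case of uniform cyclotomy -/

section SubfieldOfIndexTwo

/-- A finite field of order `p ^ (2 * k)` has a subfield of order `p ^ k`, consisting of the fixed
points of `x ↦ x ^ p ^ k`. -/
theorem exists_subfield_card {F : Type*} [Field F] [Fintype F] {p k : ℕ} (hp : p.Prime)
    (hk : k ≠ 0) (hcard : Fintype.card F = (p ^ k) ^ 2) :
    (∀ x y : F, (x + y) ^ p ^ k = x ^ p ^ k + y ^ p ^ k) ∧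
      ∃ K : Subfield F, (∀ x, x ∈ K ↔ x ^ p ^ k = x) ∧ Nat.card K = p ^ k := by
  classical
  have : Fact p.Prime := ⟨hp⟩
  have : CharP F p := charP_of_card_eq_prime_pow (f := k * 2) (by rw [hcard, pow_mul])
  refine ⟨fun x y => add_pow_char_pow x y p k, (iterateFrobenius F p k).eqLocusField (RingHom.id F),
    fun x => Iff.rfl, ?_⟩
  have h1 : 1 < p ^ k := Nat.one_lt_pow hk hp.one_lt
  -- With `s = p ^ k - 1`, the nonzero fixed points are the roots of `x ^ s = 1`, and `s (s + 2) +
  -- 1` is the order of `F`.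
  obtain ⟨s, hs⟩ : ∃ s, p ^ k = s + 1 := ⟨p ^ k - 1, by omega⟩
  have h2 := card_pow_eq_one (K := F) (e := s + 2) (f := s) (by rw [hcard, hs]; ring)
  have h3 : ((iterateFrobenius F p k).eqLocusField (RingHom.id F) : Set F) =
      ((insert 0 ({x : F | x ^ s = 1} : Finset F) : Finset F) : Set F) := by
    ext x
    simp only [Finset.coe_insert, Set.mem_insert_iff, Finset.mem_filter,
      Finset.mem_univ, true_and, SetLike.mem_coe, RingHom.mem_eqLocusField,
      iterateFrobenius_def, RingHom.id_apply]
    rw [hs, pow_succ]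
    by_cases hx : x = 0
    · simp [hx]
    · simp [hx]
  have h4 : Nat.card ((iterateFrobenius F p k).eqLocusField (RingHom.id F)) =
      Set.ncard ((iterateFrobenius F p k).eqLocusField (RingHom.id F) : Set F) := rfl
  rw [h4, h3, Set.ncard_coe_finset, Finset.card_insert_of_notMem, h2, hs]
  have : s ≠ 0 := by omega
  simp [this]

variable {F : Type*} [Field F] [Fintype F] [DecidableEq F] {r : ℕ} {K : Subfield F}

omit [DecidableEq F] in
theorem one_lt_card_sqrt (hcard : Fintype.card F = r ^ 2) : 1 < r := by
  have := Fintype.one_lt_card (α := F)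
  rw [hcard] at this
  exact lt_of_pow_lt_pow_left₀ 2 (by omega) (by simpa using this)

omit [DecidableEq F] in
theorem pow_pow_card_sqrt (hcard : Fintype.card F = r ^ 2) (x : F) : (x ^ r) ^ r = x := by
  rw [← pow_mul, ← sq, ← hcard, FiniteField.pow_card]

omit [Fintype F] [DecidableEq F] in
theorem sum_subfield_addChar (ψ : AddChar F ℂ) (hKr : Nat.card K = r) (x : F)
    [Fintype K] [Decidable (∀ k : K, ψ (k * x) = 1)] :
    ∑ k : K, ψ (k * x) = if ∀ k : K, ψ (k * x) = 1 then (r : ℂ) else 0 := by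
  split_ifs with h
  · simp [h, ← hKr]
  · have := AddChar.sum_eq_zero_of_ne_one
      (ψ := ψ.compAddMonoidHom ((AddMonoidHom.mulRight x).comp K.subtype.toAddMonoidHom)) (by
        rw [AddChar.ne_one_iff]
        push Not at h
        simpa using h)
    simpa using this

/-- The double sum of `ψ (k x)` is `r ^ 2` (only `k = 0` contributes) and also `r` times the size of
the annihilator. -/
theorem card_annihilator {ψ : AddChar F ℂ} (hψ : ψ.IsPrimitive)
    (hcard : Fintype.card F = r ^ 2) (hKr : Nat.card K = r) :
    {x : F | ∀ k : K, ψ (k * x) = 1}.ncard = r := by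
  classical
  have hr : r ≠ 0 := by
    rintro rfl
    simp at hcard
  have h1 : ∑ x : F, ∑ k : K, ψ (k * x) = (r : ℂ) ^ 2 := by
    rw [Finset.sum_comm]
    rw [Finset.sum_eq_single (0 : K)]
    · simp [hcard]
    · intro k _ hk
      have := sum_addChar_mul hψ (k : F)
      rw [if_neg (by simpa using hk)] at this
      simpa [mul_comm] using this
    · simp
  simp_rw [sum_subfield_addChar ψ hKr] at h1
  rw [← Finset.sum_filter, Finset.sum_const, nsmul_eq_mul, sq] at h1
  have h2 := mul_right_cancel₀ (by exact_mod_cast hr) h1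
  rw [Set.ncard_eq_toFinset_card', Set.toFinset_ofPred]
  exact_mod_cast h2

/-- An additive character of `F` can be rescaled so that the subfield of index two is its own
annihilator. -/
theorem exists_addChar_annihilator (hcard : Fintype.card F = r ^ 2) (hKr : Nat.card K = r) :
    ∃ ψ : AddChar F ℂ, ψ.IsPrimitive ∧ ∀ x : F, (∀ k : K, ψ (k * x) = 1) ↔ x ∈ K := by
  have hψ := AddChar.FiniteField.primitiveChar_to_Complex_isPrimitive F
  set ψ := AddChar.FiniteField.primitiveChar_to_Complex F
  have hr := one_lt_card_sqrt hcard
  have h1 := card_annihilator hψ hcard hKr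
  -- Twisting by a nonzero `u` in the annihilator of `K` puts `K` inside its new annihilator; equal
  -- cardinalities finish.
  obtain ⟨u, hu, hu0⟩ := Set.exists_ne_of_one_lt_ncard (h1.symm ▸ hr) (0 : F)
  have hψ' : (ψ.mulShift u).IsPrimitive :=
    AddChar.IsPrimitive.of_ne_one (hψ hu0)
  refine ⟨ψ.mulShift u, hψ', ?_⟩
  have h2 : (K : Set F) = {x : F | ∀ k : K, ψ.mulShift u (k * x) = 1} := by
    refine Set.eq_of_subset_of_ncard_le ?_ ?_
    · intro x hx k
      have := hu (k * ⟨x, hx⟩)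
      rw [AddChar.mulShift_apply]
      simpa [mul_comm] using this
    · rw [card_annihilator hψ' hcard hKr]
      exact hKr.ge
  intro x
  exact (Set.ext_iff.1 h2 x).symm

/-- Periods when the multiplicative group of the subfield of index two lies in the group
`x ^ f = 1`. -/
theorem hasUniformPeriods_of_dvd (hcard : Fintype.card F = r ^ 2)
    (hK : ∀ x, x ∈ K ↔ x ^ r = x) (hKr : Nat.card K = r) {e f : ℕ}
    (hef : e * f + 1 = Fintype.card F) (he : e ∣ r + 1) :
    ∃ ψ : AddChar F ℂ, ψ.IsPrimitive ∧ HasUniformPeriods ψ e f r 1 := by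
  classical
  obtain ⟨ψ, hψ, hann⟩ := exists_addChar_annihilator hcard hKr
  refine ⟨ψ, hψ, fun t ht => ?_⟩
  have hr := one_lt_card_sqrt hcard
  obtain ⟨s, rfl⟩ : ∃ s, r = s + 1 := ⟨r - 1, by omega⟩
  obtain ⟨c, hc⟩ := he
  have he0 : 0 < e := Nat.pos_of_ne_zero (by rintro rfl; omega)
  have hf : f = s * c := by
    refine Nat.eq_of_mul_eq_mul_left he0 ?_
    rw [hcard] at hef
    have : e * (s * c) = s * (s + 1 + 1) := by rw [hc]; ring
    rw [this]
    linarith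
  have hf0 : f ≠ 0 := by
    rintro rfl
    have := Fintype.one_lt_card (α := F)
    omega
  have hKf : ∀ k : F, k ∈ K → k ≠ 0 → k ^ f = 1 := by
    intro k hk hk0
    rw [hK, pow_succ, mul_eq_right₀ hk0] at hk
    rw [hf, pow_mul, hk, one_pow]
  set P : ℂ := ∑ x : F, (if x ^ f = 1 then ψ (t * x) else 0)
  have h1 : ∀ k : K, k ≠ 0 → ∑ x : F, (if x ^ f = 1 then ψ (k * (t * x)) else 0) = P := by
    intro k hk
    have hk0 : (k : F) ≠ 0 := by simpa using hk
    refine Fintype.sum_equiv (Equiv.mulLeft₀ (k : F) hk0) _ _ fun x => ?_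
    change _ = if ((k : F) * x) ^ f = 1 then ψ (t * (k * x)) else 0
    rw [mul_pow, hKf k k.2 hk0, one_mul, mul_left_comm]
  have hcf : ∑ x : F, (if x ^ f = 1 then (1 : ℂ) else 0) = f := by
    rw [Finset.sum_boole, card_pow_eq_one hef]
  have hK1 : (Finset.univ.erase (0 : K)).card = s := by
    rw [Finset.card_erase_of_mem (Finset.mem_univ _), Finset.card_univ,
      ← Nat.card_eq_fintype_card, hKr, Nat.add_sub_cancel]
  -- The double sum is evaluated twice: here each nonzero `k` merely permutes the group and gives
  -- `P`; in `h3`, summing over `k` first counts the `x` with `t * x ∈ K`.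
  have h2 : ∑ k : K, ∑ x : F, (if x ^ f = 1 then ψ (k * (t * x)) else 0) = f + s * P := by
    rw [← Finset.add_sum_erase _ _ (Finset.mem_univ (0 : K))]
    rw [Finset.sum_congr rfl fun k hk => h1 k (Finset.ne_of_mem_erase hk), Finset.sum_const, hK1]
    simp [hcf]
  have hcount : Finset.card {x : F | x ^ f = 1 ∧ t * x ∈ K} = if t ^ f = 1 then s else 0 := by
    split_ifs with htf
    · rw [← hK1]
      symm
      refine Finset.card_bij (fun (k : K) _ => t⁻¹ * (k : F)) ?_ ?_ ?_
      · intro k hk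
        have hk0 : (k : F) ≠ 0 := by simpa using Finset.ne_of_mem_erase hk
        simp [mul_pow, hKf k k.2 hk0, htf, ht]
      · intro a _ b _ h
        simpa [ht] using h
      · intro x hx
        rw [Finset.mem_filter] at hx
        refine ⟨⟨t * x, hx.2.2⟩, ?_, by simp [ht]⟩
        rw [Finset.mem_erase]
        refine ⟨fun h0 => ?_, Finset.mem_univ _⟩
        rw [Subtype.ext_iff] at h0
        have hx0 : x = 0 := by simpa [ht] using h0
        rw [hx0, zero_pow hf0] at hx
        exact zero_ne_one hx.2.1
    · rw [Finset.card_eq_zero, Finset.filter_eq_empty_iff]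
      rintro x - ⟨hx, hxK⟩
      have hx0 : x ≠ 0 := by
        rintro rfl
        rw [zero_pow hf0] at hx
        exact zero_ne_one hx
      have := hKf _ hxK (mul_ne_zero ht hx0)
      rw [mul_pow, hx, mul_one] at this
      exact htf this
  have h3 : ∑ k : K, ∑ x : F, (if x ^ f = 1 then ψ (k * (t * x)) else 0) =
      (s + 1) * if t ^ f = 1 then (s : ℂ) else 0 := by
    rw [Finset.sum_comm]
    have : ∀ x : F, ∑ k : K, (if x ^ f = 1 then ψ (k * (t * x)) else 0) =
        (s + 1) * if x ^ f = 1 ∧ t * x ∈ K then 1 else 0 := by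
      intro x
      by_cases hx : x ^ f = 1
      · simp only [hx, if_true, true_and]
        rw [sum_subfield_addChar ψ hKr]
        simp only [hann]
        push_cast
        split_ifs <;> simp
      · simp [hx]
    rw [Finset.sum_congr rfl fun x _ => this x, ← Finset.mul_sum, Finset.sum_boole, hcount]
    push_cast
    rfl
  rw [h2] at h3
  have hs : (s : ℂ) ≠ 0 := by
    have : s ≠ 0 := by omega
    exact_mod_cast this
  refine mul_left_cancel₀ hs ?_
  have hefC : (e : ℂ) * f + 1 = (s + 1) ^ 2 := by
    rw [hcard] at hef
    exact_mod_cast hef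
  push_cast
  have h4 : (if t ^ f = 1 then (s : ℂ) else 0) = s * if t ^ f = 1 then 1 else 0 := by simp
  rw [h4] at h3
  linear_combination (e : ℂ) * h3 - hefC

end SubfieldOfIndexTwo

/-! ### Transfer of uniform periods through the norm -/

section NormForm

variable {F : Type*} [Field F] [Fintype F] [DecidableEq F] {r : ℕ} {K : Subfield F}

/-- The norm to the subfield of index two. -/
def normForm (hcard : Fintype.card F = r ^ 2) (hK : ∀ x, x ∈ K ↔ x ^ r = x) (x : F) : K :=
  ⟨x * x ^ r, by rw [hK, mul_pow, pow_pow_card_sqrt hcard, mul_comm]⟩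

/-- The trace to the subfield of index two. -/
def traceHom (hcard : Fintype.card F = r ^ 2) (hadd : ∀ x y : F, (x + y) ^ r = x ^ r + y ^ r)
    (hK : ∀ x, x ∈ K ↔ x ^ r = x) : F →+ K where
  toFun x := ⟨x + x ^ r, by rw [hK, hadd, pow_pow_card_sqrt hcard, add_comm]⟩
  map_zero' := by
    have hr : r ≠ 0 := by
      rintro rfl
      simp at hcard
    ext
    simp [hr]
  map_add' x y := by
    ext
    simp only [hadd, Subfield.coe_add]
    ring

variable (hcard : Fintype.card F = r ^ 2) (hadd : ∀ x y : F, (x + y) ^ r = x ^ r + y ^ r)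
  (hK : ∀ x, x ∈ K ↔ x ^ r = x)

omit [DecidableEq F] in
-- If `c = g ^ i` lies in `K`, then `c ^ (r - 1) = 1` forces `r + 1 ∣ i`, and `g ^ (i / (r + 1))`
-- has norm `c`.
theorem normForm_surjective (c : K) : ∃ y, normForm hcard hK y = c := by
  classical
  have hr := one_lt_card_sqrt hcard
  by_cases hc : c = 0
  · refine ⟨0, ?_⟩
    ext
    simp [normForm, hc]
  obtain ⟨s, rfl⟩ : ∃ s, r = s + 1 := ⟨r - 1, by omega⟩
  have hc0 : (c : F) ≠ 0 := by simpa using hc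
  obtain ⟨g, hg⟩ := IsCyclic.exists_generator (α := Fˣ)
  have ho : orderOf g = s * (s + 2) := by
    rw [orderOf_eq_card_of_forall_mem_zpowers hg, Nat.card_eq_fintype_card, Fintype.card_units,
      hcard]
    have : (s + 1) ^ 2 = s * (s + 2) + 1 := by ring
    omega
  obtain ⟨i, hi⟩ : ∃ i : ℕ, g ^ i = Units.mk0 (c : F) hc0 := by
    have := hg (Units.mk0 (c : F) hc0)
    rwa [← mem_powers_iff_mem_zpowers] at this
  have hcs : (Units.mk0 (c : F) hc0) ^ s = 1 := by
    ext
    have := (hK c).1 c.2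
    rw [pow_succ, mul_eq_right₀ hc0] at this
    simpa using this
  rw [← hi, ← pow_mul, ← orderOf_dvd_iff_pow_eq_one, ho, mul_comm i] at hcs
  obtain ⟨l, rfl⟩ := Nat.dvd_of_mul_dvd_mul_left (by omega) hcs
  refine ⟨(g : F) ^ l, ?_⟩
  ext
  have h1 := congrArg Units.val hi
  simp only [Units.val_pow_eq_pow_val, Units.val_mk0] at h1
  rw [← h1]
  simp only [normForm]
  ring

omit [DecidableEq F] in
-- The trace is `K`-linear, so it suffices that it is nonzero. If `x ^ r = -x` always, then `x = 1`
-- gives `-1 = 1`, so every `x` is fixed and `K` is the whole field.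
theorem exists_traceHom_eq (hKr : Nat.card K = r) {w : F} (hw : w ≠ 0) (c : K) :
    ∃ x, traceHom hcard hadd hK (x * w) = c := by
  classical
  have hr := one_lt_card_sqrt hcard
  obtain ⟨x, hx⟩ : ∃ x : F, x + x ^ r ≠ 0 := by
    by_contra! h
    have h2 : ∀ x : F, x ^ r = x := by
      intro x
      have h1 := h 1
      have hx := h x
      rw [one_pow] at h1
      linear_combination hx - x * h1
    have : K = ⊤ := by
      ext x
      simp [hK, h2]
    rw [this, Nat.card_congr Subfield.topEquiv.toEquiv, Nat.card_eq_fintype_card, hcard] at hKr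
    nlinarith
  have hT0 : x + x ^ r ∈ K := by
    rw [hK, hadd, pow_pow_card_sqrt hcard, add_comm]
  have hm : (c : F) * (x + x ^ r)⁻¹ ∈ K := K.mul_mem c.2 (K.inv_mem hT0)
  refine ⟨c * (x + x ^ r)⁻¹ * x * w⁻¹, ?_⟩
  ext
  simp only [traceHom, AddMonoidHom.coe_mk, ZeroHom.coe_mk]
  rw [inv_mul_cancel_right₀ hw, mul_pow, (hK _).1 hm, ← mul_add, inv_mul_cancel_right₀ hx]

include hcard hadd hK in
/-- Periods of a field from those of its subfield of index two: the norm is an elliptic quadratic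
form, and the group `x ^ f = 1` is the preimage of the corresponding group of the subfield. -/
theorem HasUniformPeriods.of_subfield (hKr : Nat.card K = r) [Fintype K] {ψ : AddChar K ℂ}
    (hψ : ψ.IsPrimitive) {e f : ℕ} {r' δ : ℂ} (hef : e * f + 1 = r) (hr' : r' ^ 2 = r)
    (hδ : δ ^ 2 = 1) (hneg : (-1 : K) ^ f = 1) (hper : HasUniformPeriods ψ e f r' δ) :
    ∃ φ : AddChar F ℂ, φ.IsPrimitive ∧ HasUniformPeriods φ e (f * (r + 1)) r (-1) := by
  have hr := one_lt_card_sqrt hcard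
  have hKc : Fintype.card K = r := by rw [← Nat.card_eq_fintype_card, hKr]
  set T := traceHom hcard hadd hK with hT
  have hsum : ∀ w : F, w ≠ 0 → ∑ x, ψ (T (x * w)) = 0 := by
    intro w hw
    obtain ⟨k, hk⟩ := AddChar.ne_one_iff.1 (by simpa using hψ one_ne_zero : ψ ≠ 1)
    obtain ⟨x, hx⟩ := exists_traceHom_eq hcard hadd hK hKr hw k
    exact AddChar.sum_eq_zero_of_ne_one
      (ψ := ψ.compAddMonoidHom (T.comp (AddMonoidHom.mulRight w))) (by
        rw [AddChar.ne_one_iff]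
        refine ⟨x, ?_⟩
        simpa [hT, hx] using hk)
  have hφ : (ψ.compAddMonoidHom T).IsPrimitive := by
    refine AddChar.IsPrimitive.of_ne_one ?_
    obtain ⟨k, hk⟩ := AddChar.ne_one_iff.1 (by simpa using hψ one_ne_zero : ψ ≠ 1)
    obtain ⟨x, hx⟩ := exists_traceHom_eq hcard hadd hK hKr (one_ne_zero (α := F)) k
    rw [AddChar.ne_one_iff]
    rw [mul_one] at hx
    refine ⟨x, ?_⟩
    simpa [hT, hx] using hk
  refine ⟨ψ.compAddMonoidHom T, hφ, ?_⟩
  set N := normForm hcard hK with hN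
  have hQ : ∀ (x w : F) (s : K), N (x + s • w) = N x + s ^ 2 * N w + s * T (x * w ^ r) := by
    intro x w s
    ext
    simp only [hN, hT, normForm, traceHom, AddMonoidHom.coe_mk, ZeroHom.coe_mk, Subfield.coe_add,
      Subfield.coe_mul, SubmonoidClass.coe_pow, Subfield.smul_def, smul_eq_mul, hadd, mul_pow,
      (hK s).1 s.2, pow_pow_card_sqrt hcard]
    ring
  have hmul : ∀ x y, N (x * y) = N x * N y := by
    intro x y
    ext
    simp only [hN, normForm, Subfield.coe_mul]
    ring
  have hN0 : ∀ x, N x = 0 ↔ x = 0 := by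
    intro x
    rw [Subtype.ext_iff]
    simp only [hN, normForm, Subfield.coe_zero]
    rw [← pow_succ', pow_eq_zero_iff (by omega)]
  have hS1 : ∀ t : K, t ≠ 0 → ∑ x, ψ (t * N x) = ∑ x, ψ (N x) := by
    intro t ht
    obtain ⟨y, rfl⟩ := normForm_surjective hcard hK t
    have hy : y ≠ 0 := by rwa [Ne, ← hN0]
    refine Fintype.sum_equiv (Equiv.mulLeft₀ y hy) _ _ fun x => ?_
    rw [← hN, ← hmul]
    rfl
  -- Summing over all `t` gives `r`, since only `x = 0` has norm `0`; the term `t = 0` is `r ^ 2`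
  -- and the other `r - 1` terms are equal.
  have hS2 : ∑ x, ψ (N x) = -(r : ℂ) := by
    have h1 : ∑ t : K, ∑ x, ψ (t * N x) = r := by
      rw [Finset.sum_comm]
      simp_rw [sum_addChar_mul hψ, hN0, hKc]
      simp
    rw [← Finset.add_sum_erase _ _ (Finset.mem_univ (0 : K)),
      Finset.sum_congr rfl fun t ht => hS1 t (Finset.ne_of_mem_erase ht), Finset.sum_const,
      Finset.card_erase_of_mem (Finset.mem_univ _), Finset.card_univ, hKc, nsmul_eq_mul,
      Nat.cast_sub hr.le] at h1
    simp only [zero_mul, AddChar.map_zero_eq_one, Finset.sum_const, Finset.card_univ, hcard,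
      nsmul_eq_mul, mul_one] at h1
    push_cast at h1
    have hr1 : (r : ℂ) - 1 ≠ 0 := by
      rw [sub_ne_zero]
      exact_mod_cast hr.ne'
    refine mul_left_cancel₀ hr1 ?_
    linear_combination h1
  intro t ht
  -- The transform is evaluated at `t ^ r`, since the polar form pairs `x` with `(t ^ r) ^ r = t`.
  have hw : t ^ r ≠ 0 := pow_ne_zero _ ht
  have hb : ∑ x, ψ (T (x * (t ^ r) ^ r)) = 0 := hsum _ (pow_ne_zero _ hw)
  have main := card_mul_sum_cyclotomic hψ (b := fun x w => T (x * w ^ r)) hQ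
    (fun t ht => (hS1 t ht).trans hS2) hb (hef.trans hKc.symm) (hr'.trans (by rw [hKc])) hδ hneg
    hper (one_ne_zero (α := K))
  have hNf : ∀ x, N x ^ f = 1 ↔ x ^ (f * (r + 1)) = 1 := by
    intro x
    rw [Subtype.ext_iff]
    simp only [hN, normForm, SubmonoidClass.coe_pow, Subfield.coe_one]
    rw [← pow_succ', ← pow_mul, mul_comm f]
  have htf : (t ^ r) ^ (f * (r + 1)) = 1 ↔ t ^ (f * (r + 1)) = 1 := by
    refine ⟨fun h => ?_, fun h => ?_⟩
    · have h2 : ((t ^ r) ^ r) ^ (f * (r + 1)) = 1 := by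
        rw [pow_right_comm, h, one_pow]
      rwa [pow_pow_card_sqrt hcard] at h2
    · rw [pow_right_comm, h, one_pow]
  simp only [one_pow, one_mul, hNf, pow_pow_card_sqrt hcard, htf, hKc] at main
  have hr0 : (r : ℂ) ≠ 0 := by
    have : r ≠ 0 := by omega
    exact_mod_cast this
  refine mul_left_cancel₀ hr0 ?_
  have h3 : ∑ x, (if x ^ (f * (r + 1)) = 1 then (ψ.compAddMonoidHom T) (t * x) else 0) =
      ∑ x, (if x ^ (f * (r + 1)) = 1 then 1 else 0) * ψ (T (x * t)) := by
    refine Finset.sum_congr rfl fun x _ => ?_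
    rw [ite_mul, one_mul, zero_mul, mul_comm t]
    rfl
  rw [h3, main]
  ring

end NormForm

/-! ### Uniform cyclotomy -/

theorem dvd_pow_sub_one_of_dvd_pow_add_one {p j e : ℕ} (he : e ∣ p ^ j + 1) (γ : ℕ) :
    e ∣ p ^ (2 * j * γ) - 1 := by
  have h1 : (p ^ j) ^ 2 - 1 ∣ ((p ^ j) ^ 2) ^ γ - 1 := by
    simpa using Nat.sub_dvd_pow_sub_pow ((p ^ j) ^ 2) 1 γ
  have h2 : p ^ j + 1 ∣ (p ^ j) ^ 2 - 1 :=
    ⟨p ^ j - 1, by simpa using Nat.sq_sub_sq (p ^ j) 1⟩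
  rw [mul_comm 2 j, pow_mul, pow_mul]
  exact he.trans (h2.trans h1)

/-- For odd `p`, `f` is a multiple of `(p ^ j - 1) * ((p ^ j + 1) / e)`, whose first factor is even.
-/
theorem neg_one_pow_eq_one_of_dvd {F : Type*} [Field F] [Fintype F] {p j γ e f : ℕ}
    (hp : p.Prime) (he : e ∣ p ^ j + 1)
    (hcard : Fintype.card F = p ^ (2 * j * γ)) (hef : e * f + 1 = Fintype.card F) :
    (-1 : F) ^ f = 1 := by
  have : Fact p.Prime := ⟨hp⟩
  have : CharP F p := charP_of_card_eq_prime_pow hcard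
  rcases hp.eq_two_or_odd' with rfl | hodd
  · rw [CharTwo.neg_eq, one_pow]
  · refine Even.neg_one_pow ?_
    obtain ⟨c, hc⟩ := he
    obtain ⟨a, ha⟩ : Odd (p ^ j) := hodd.pow
    have h1 : (p ^ j) ^ 2 - 1 ∣ ((p ^ j) ^ 2) ^ γ - 1 := by
      simpa using Nat.sub_dvd_pow_sub_pow ((p ^ j) ^ 2) 1 γ
    have h2 : ((p ^ j) ^ 2) ^ γ - 1 = e * f := by
      rw [← pow_mul, ← pow_mul, ← mul_assoc, mul_comm j 2, ← hcard, ← hef, Nat.add_sub_cancel]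
    have h3 : (p ^ j) ^ 2 - 1 = e * (c * (2 * a)) := by
      have : (p ^ j) ^ 2 = (p ^ j + 1) * (2 * a) + 1 := by rw [ha]; ring
      rw [this, hc, Nat.add_sub_cancel, mul_assoc]
    have he0 : 0 < e := Nat.pos_of_ne_zero (by rintro rfl; omega)
    rw [h2, h3] at h1
    obtain ⟨d, hd⟩ := Nat.dvd_of_mul_dvd_mul_left he0 h1
    exact ⟨c * a * d, by rw [hd]; ring⟩

/-- Uniform cyclotomy: if `e` divides `p ^ j + 1`, the Gaussian periods of order `e` of a field
with `p ^ (2 * j * γ)` elements are uniform. -/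
theorem exists_hasUniformPeriods {p j e : ℕ} (hp : p.Prime) (hj : j ≠ 0) (he : e ∣ p ^ j + 1)
    (γ : ℕ) : γ ≠ 0 → ∀ (F : Type*) [Field F] [Fintype F] [DecidableEq F] (f : ℕ),
      Fintype.card F = p ^ (2 * j * γ) → e * f + 1 = Fintype.card F →
        ∃ (ψ : AddChar F ℂ) (δ : ℂ), ψ.IsPrimitive ∧ δ ^ 2 = 1 ∧
          HasUniformPeriods ψ e f ((p ^ (j * γ) : ℕ) : ℂ) δ := by
  classical
  induction γ using Nat.strong_induction_on with
  | _ γ ih =>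
    intro hγ F _ _ _ f hcard hef
    have hcard' : Fintype.card F = (p ^ (j * γ)) ^ 2 := by
      rw [hcard, ← pow_mul]
      ring_nf
    obtain ⟨hadd, K, hK, hKr⟩ := exists_subfield_card hp (mul_ne_zero hj hγ) hcard'
    have he0 : 0 < e := Nat.pos_of_ne_zero (by rintro rfl; simp at he)
    rcases Nat.even_or_odd' γ with ⟨c, rfl | hc⟩
    · have hc0 : c ≠ 0 := by omega
      have hKcard : Fintype.card K = p ^ (2 * j * c) := by
        rw [← Nat.card_eq_fintype_card, hKr]
        ring_nf
      have hdvd := dvd_pow_sub_one_of_dvd_pow_add_one he c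
      rw [mul_comm 2 j, mul_assoc] at hdvd
      obtain ⟨f', hf'⟩ := hdvd
      have hpos : 0 < p ^ (j * (2 * c)) := pow_pos hp.pos _
      have hef' : e * f' + 1 = p ^ (j * (2 * c)) := by omega
      obtain ⟨ψ, δ, hψ, hδ, hper⟩ := ih c (by omega) hc0 K f' hKcard
        (by rw [hef', ← hKr, Nat.card_eq_fintype_card])
      obtain ⟨φ, hφ, hφper⟩ := hper.of_subfield hcard' hadd hK hKr hψ hef'
        (by push_cast; ring) hδ
        (neg_one_pow_eq_one_of_dvd hp he hKcard
          (by rw [hef', ← hKr, Nat.card_eq_fintype_card]))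
      refine ⟨φ, -1, hφ, by norm_num, ?_⟩
      have : f = f' * (p ^ (j * (2 * c)) + 1) := by
        refine Nat.eq_of_mul_eq_mul_left he0 (Nat.add_right_cancel (m := 1) ?_)
        rw [hef, hcard', ← hef']
        ring
      rw [this]
      exact hφper
    · have hdvd : e ∣ p ^ (j * γ) + 1 := by
        have : p ^ j + 1 ∣ (p ^ j) ^ γ + 1 := by
          have := (show Odd γ from ⟨c, hc⟩).nat_add_dvd_pow_add_pow (p ^ j) 1
          simpa using this
        rw [pow_mul]
        exact he.trans this
      obtain ⟨ψ, hψ, hper⟩ := hasUniformPeriods_of_dvd hcard' hK hKr hef hdvd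
      exact ⟨ψ, 1, hψ, one_pow 2, hper⟩

/-! ### Nondegeneracy of the polar form -/

section Nondegenerate

/-- In characteristic two, alternating matrices of odd size are singular. -/
theorem det_eq_zero_of_alternating {n R : Type*} [Fintype n] [DecidableEq n] [CommRing R]
    [CharP R 2] {A : Matrix n n R} (hsymm : ∀ i j, A i j = A j i) (hdiag : ∀ i, A i i = 0)
    (hodd : Odd (Fintype.card n)) : A.det = 0 := by
  have hsign : ∀ σ : Equiv.Perm n, (((Equiv.Perm.sign σ : ℤˣ) : ℤ) : R) = 1 := by
    intro σ
    rcases Int.units_eq_one_or (Equiv.Perm.sign σ) with h | h <;> simp [h, CharTwo.neg_eq]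
  rw [Matrix.det_apply']
  simp only [hsign, one_mul]
  refine Finset.sum_involution (fun σ _ => σ⁻¹) ?_ ?_ (fun _ _ => Finset.mem_univ _)
    (fun σ _ => inv_inv σ)
  · intro σ _
    have : ∏ i, A (σ⁻¹ i) i = ∏ i, A (σ i) i := by
      refine (Fintype.prod_equiv σ _ _ fun i => ?_).symm
      rw [Equiv.Perm.coe_inv, Equiv.symm_apply_apply, hsymm]
    rw [this, CharTwo.add_self_eq_zero]
  · intro σ _ hne hσ
    apply hne
    -- A permutation equal to its inverse fixes a point of a set of odd size, so its term contains a
    -- diagonal zero.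
    have : Fact (Nat.Prime 2) := ⟨Nat.prime_two⟩
    obtain ⟨a, ha⟩ := Equiv.Perm.exists_fixed_point_of_prime (p := 2) (n := 1) (σ := σ)
      (by rwa [← even_iff_two_dvd, Nat.not_even_iff_odd]) (by
        rw [pow_one, sq]
        nth_rewrite 1 [← hσ]
        exact inv_mul_cancel σ)
    exact Finset.prod_eq_zero (Finset.mem_univ a) (by rw [ha, hdiag])

variable {F V : Type*} [Field F] [Finite F] [AddCommGroup V] [Module F V] [FiniteDimensional F V]

/-- Over a finite field, the polar form of a nonsingular quadratic form in an even number of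
variables is nondegenerate. -/
theorem exists_polar_ne_zero (Q : QuadraticForm F V) (hQ : Q.radical = ⊥)
    (hV : Even (Module.finrank F V)) {w : V} (hw : w ≠ 0) : ∃ x, QuadraticMap.polar Q x w ≠ 0 := by
  by_contra! h
  have hQw : Q w ≠ 0 := by
    intro h0
    apply hw
    have : w ∈ Q.radical := by
      rw [QuadraticMap.mem_radical_iff']
      refine ⟨h0, fun n => ?_⟩
      have := h n
      rw [QuadraticMap.polar_comm, QuadraticMap.polar, h0] at this
      linear_combination this
    rwa [hQ, Submodule.mem_bot] at this
  have h2 : (2 : F) = 0 := by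
    have := h w
    rw [QuadraticMap.polar_self, nsmul_eq_mul] at this
    exact (mul_eq_zero.1 this).resolve_right hQw
  have : CharP F 2 := CharTwo.of_one_ne_zero_of_two_eq_zero one_ne_zero h2
  -- The radical of the polar form is the line through `w`: every scalar is a square, so some `c •
  -- w` has the value `Q v`, and `c • w - v` is then in the radical of `Q`.
  have hrad : ∀ v, (∀ x, QuadraticMap.polar Q x v = 0) → ∃ c : F, c • w = v := by
    intro v hv
    obtain ⟨c, hc⟩ := FiniteField.isSquare_of_char_two (ringChar.eq F 2) (Q v / Q w)
    refine ⟨c, sub_eq_zero.1 ?_⟩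
    have hmem : c • w - v ∈ Q.radical := by
      have hp : ∀ x, QuadraticMap.polar Q (c • w - v) x = 0 := by
        intro x
        rw [QuadraticMap.polar_sub_left, QuadraticMap.polar_smul_left, QuadraticMap.polar_comm,
          h, QuadraticMap.polar_comm, hv, smul_zero, sub_zero]
      have h0 : Q (c • w - v) = 0 := by
        have h1 := QuadraticMap.polar_neg_right Q (c • w) v
        rw [hv, neg_zero, QuadraticMap.polar, QuadraticMap.map_neg, ← sub_eq_add_neg] at h1
        have h3 := QuadraticMap.map_smul Q c w
        rw [← hc, smul_eq_mul, div_mul_cancel₀ _ hQw] at h3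
        linear_combination h1 + h3 + Q v * h2
      rw [QuadraticMap.mem_radical_iff']
      refine ⟨h0, fun n => ?_⟩
      have := hp n
      rw [QuadraticMap.polar, h0] at this
      linear_combination this
    rwa [hQ, Submodule.mem_bot] at hmem
  -- A complement `W` of this line has odd dimension, so the alternating form has a nonzero kernel
  -- vector on `W`. It is orthogonal to `w` as well, hence lies on the line, a contradiction.
  obtain ⟨W, hW⟩ := Submodule.exists_isCompl (Submodule.span F {w})
  have hfr := Submodule.finrank_add_eq_of_isCompl hW
  rw [finrank_span_singleton hw] at hfr
  let b := Module.finBasis F W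
  have hdet := det_eq_zero_of_alternating
    (A := Matrix.of fun i j => QuadraticMap.polar Q (b i : V) (b j : V))
    (fun i j => QuadraticMap.polar_comm _ _ _)
    (fun i => by
      rw [Matrix.of_apply, QuadraticMap.polar_self, nsmul_eq_mul, Nat.cast_ofNat, h2, zero_mul])
    (by
      rw [Fintype.card_fin, ← Nat.not_even_iff_odd]
      intro hev
      rw [← hfr, Nat.even_add] at hV
      exact Nat.not_even_one (hV.2 hev))
  obtain ⟨v, hv0, hv⟩ := Matrix.exists_mulVec_eq_zero_iff.2 hdet
  let y : W := ∑ j, v j • b j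
  have hy0 : y ≠ 0 := by
    intro h0
    apply hv0
    ext j
    exact Fintype.linearIndependent_iff.1 b.linearIndependent v h0 j
  have hby : ∀ i, Q.polarBilin (y : V) (b i : V) = 0 := by
    intro i
    have := congrFun hv i
    rw [Pi.zero_apply, Matrix.mulVec, dotProduct] at this
    rw [← this]
    simp only [y, Submodule.coe_sum, map_sum, LinearMap.sum_apply, Submodule.coe_smul, map_smul,
      LinearMap.smul_apply, QuadraticMap.polarBilin_apply_apply, Matrix.of_apply, smul_eq_mul]
    exact Finset.sum_congr rfl fun j _ => by rw [mul_comm, QuadraticMap.polar_comm]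
  have hyW : (Q.polarBilin (y : V)).comp W.subtype = 0 := b.ext hby
  obtain ⟨c, hc⟩ := hrad y (by
    intro x
    obtain ⟨a, ha, z, hz, rfl⟩ := Submodule.mem_sup.1
      (hW.sup_eq_top.symm ▸ Submodule.mem_top : x ∈ Submodule.span F {w} ⊔ W)
    obtain ⟨k, rfl⟩ := Submodule.mem_span_singleton.1 ha
    have h1 : QuadraticMap.polar Q (y : V) z = 0 := LinearMap.congr_fun hyW ⟨z, hz⟩
    rw [QuadraticMap.polar_add_left, QuadraticMap.polar_smul_left, QuadraticMap.polar_comm Q w, h,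
      QuadraticMap.polar_comm Q z, h1, smul_zero, add_zero])
  apply hy0
  have := Submodule.disjoint_def.1 hW.disjoint (y : V)
    (Submodule.mem_span_singleton.2 ⟨c, hc⟩) y.2
  exact Subtype.ext this

end Nondegenerate

/-! ### Exponential sums and values of quadratic forms -/

section ExponentialSums

theorem addChar_sum_eq_prod {A ι : Type*} [AddCommMonoid A] (ψ : AddChar A ℂ) (s : Finset ι)
    (f : ι → A) : ψ (∑ i ∈ s, f i) = ∏ i ∈ s, ψ (f i) := by
  classical
  induction s using Finset.induction_on with
  | empty => simp
  | insert a s ha ih => rw [Finset.sum_insert ha, Finset.prod_insert ha, ψ.map_add_eq_mul, ih]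

variable {F : Type*} [Field F] [Fintype F] [DecidableEq F] {ψ : AddChar F ℂ}

/-- One-variable quadratic Gauss sums change by the quadratic character under scaling. -/
theorem sum_addChar_sq_mul (hψ : ψ.IsPrimitive) (hF : ringChar F ≠ 2) {t a : F} (ht : t ≠ 0)
    (ha : a ≠ 0) :
    ∑ y, ψ (t * (a * (y * y))) = (quadraticChar F t : ℂ) * ∑ y, ψ (a * (y * y)) := by
  set χ : MulChar F ℂ := (quadraticChar F).ringHomComp (Int.castRingHom ℂ)
  have hχa : ∀ x, χ x = (quadraticChar F x : ℂ) := fun x => rfl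
  have key : ∀ a : F, a ≠ 0 → χ a * ∑ y, ψ (a * (y * y)) = gaussSum χ ψ := by
    intro a ha
    rw [← gaussSum_mulShift χ ψ (Units.mk0 a ha), Units.val_mk0]
    congr 1
    -- Group by `z = y ^ 2`: there are `χ z + 1` square roots, and the constant `1` contributes a
    -- vanishing sum.
    have h1 : ∑ y, ψ (a * (y * y)) =
        ∑ z : F, ∑ y : F, (if y ^ 2 = z then ψ (a * z) else 0) := by
      rw [Finset.sum_comm]
      refine Finset.sum_congr rfl fun y _ => ?_
      rw [Finset.sum_ite_eq, if_pos (Finset.mem_univ _), sq]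
    have h2 : ∀ z : F, ∑ y : F, (if y ^ 2 = z then ψ (a * z) else 0) =
        χ z * ψ (a * z) + ψ (a * z) := by
      intro z
      have := quadraticChar_card_sqrts hF z
      rw [Set.toFinset_ofPred] at this
      rw [← Finset.sum_filter, Finset.sum_const, nsmul_eq_mul, hχa]
      have h3 : ((Finset.card {y : F | y ^ 2 = z} : ℕ) : ℂ) = (quadraticChar F z : ℂ) + 1 := by
        exact_mod_cast this
      rw [h3]
      ring
    have h3 : ∑ z, ψ (a * z) = 0 := by
      have := sum_addChar_mul hψ a
      rw [if_neg ha] at this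
      simpa only [mul_comm a] using this
    rw [h1, Finset.sum_congr rfl fun z _ => h2 z, Finset.sum_add_distrib, h3, add_zero, gaussSum]
    rfl
  have h1 := key a ha
  have h2 := key (t * a) (mul_ne_zero ht ha)
  simp only [mul_assoc] at h2
  rw [← h1, map_mul, mul_right_comm, mul_comm (χ t), mul_assoc] at h2
  have ha2 : χ a ^ 2 = 1 := by rw [hχa]; exact_mod_cast quadraticChar_sq_one ha
  have ht2 : χ t ^ 2 = 1 := by rw [hχa]; exact_mod_cast quadraticChar_sq_one ht
  rw [← hχa]
  set S := ∑ y, ψ (t * (a * (y * y)))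
  set S' := ∑ y, ψ (a * (y * y))
  have h4 : χ a * (S * χ t) = χ a * S' := by linear_combination h2
  have ha0 : χ a ≠ 0 := by
    intro h0
    rw [h0] at ha2
    norm_num at ha2
  have h5 := mul_left_cancel₀ ha0 h4
  linear_combination χ t * h5 - S * ht2

variable {V : Type*} [AddCommGroup V] [Module F V] [Fintype V]

/-- The exponential sum of a nonsingular quadratic form in an even number of variables is
invariant under scaling of the form. -/
theorem sum_addChar_quadraticForm (hψ : ψ.IsPrimitive) (Q : QuadraticForm F V)
    (hQ : Q.radical = ⊥) (hV : Even (Module.finrank F V)) {t : F} (ht : t ≠ 0) :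
    ∑ x, ψ (t * Q x) = ∑ x, ψ (Q x) := by
  by_cases hF : ringChar F = 2
  -- In characteristic two `t = s * s`, and the scaling is absorbed by `x ↦ s • x`.
  · obtain ⟨s, rfl⟩ := FiniteField.isSquare_of_char_two hF t
    have hs : s ≠ 0 := left_ne_zero_of_mul ht
    refine Fintype.sum_bijective (fun x => s • x) (MulAction.bijective₀ hs) _ _ fun x => ?_
    rw [QuadraticMap.map_smul, smul_eq_mul]
  -- In odd characteristic, diagonalize: each variable contributes the quadratic character of `t`,
  -- and there is an even number of variables.
  · have h2 : (2 : F) ≠ 0 := Ring.two_ne_zero hF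
    let _ : Invertible (2 : F) := invertibleOfNonzero h2
    have hsep : (QuadraticMap.associated (R := F) Q).SeparatingLeft := by
      rw [LinearMap.separatingLeft_iff_ker_eq_bot, ← QuadraticMap.radical_eq_ker_associated, hQ]
    obtain ⟨w, ⟨φ⟩⟩ := Q.equivalent_weightedSumSquares_units_of_nondegenerate' hsep
    have key : ∀ t : F, ∑ x, ψ (t * Q x) =
        ∏ i, ∑ y, ψ (t * ((w i : F) * (y * y))) := by
      intro t
      rw [Fintype.prod_sum]
      refine Fintype.sum_equiv φ.toEquiv _ _ fun x => ?_
      have hx : Q x = QuadraticMap.weightedSumSquares F w (φ x) := (φ.map_app x).symm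
      rw [hx, QuadraticMap.weightedSumSquares_apply, Finset.mul_sum, addChar_sum_eq_prod]
      rfl
    have key1 := key 1
    simp only [one_mul] at key1
    rw [key, key1, Finset.prod_congr rfl fun i _ => sum_addChar_sq_mul hψ hF ht (w i).ne_zero,
      Finset.prod_mul_distrib, Finset.prod_const, Finset.card_univ, Fintype.card_fin]
    obtain ⟨k, hk⟩ := hV
    have ht2 : (quadraticChar F t : ℂ) ^ 2 = 1 := by exact_mod_cast quadraticChar_sq_one ht
    have hpow : (quadraticChar F t : ℂ) ^ Module.finrank F V = 1 := by
      rw [hk, ← two_mul, pow_mul, ht2, one_pow]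
    rw [hpow, one_mul]

omit [DecidableEq F] in
theorem sum_addChar_polar (hψ : ψ.IsPrimitive) (Q : QuadraticForm F V)
    (hQ : Q.radical = ⊥) (hV : Even (Module.finrank F V)) {w : V} (hw : w ≠ 0) :
    ∑ x, ψ (QuadraticMap.polar Q x w) = 0 := by
  obtain ⟨x, hx⟩ := exists_polar_ne_zero Q hQ hV hw
  obtain ⟨k, hk⟩ := AddChar.ne_one_iff.1 (by simpa using hψ one_ne_zero : ψ ≠ 1)
  refine AddChar.sum_eq_zero_of_ne_one
    (ψ := ψ.compAddMonoidHom (Q.polarBilin.flip w).toAddMonoidHom) ?_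
  rw [AddChar.ne_one_iff]
  refine ⟨(k * (QuadraticMap.polar Q x w)⁻¹) • x, ?_⟩
  change ψ (QuadraticMap.polar Q _ w) ≠ 1
  rwa [QuadraticMap.polar_smul_left, smul_eq_mul, inv_mul_cancel_right₀ hx]

/-- The characters `x ↦ ψ (B (x, w))` for the polar form `B` of a quadratic form. -/
def polarAddChar (ψ : AddChar F ℂ) (Q : QuadraticForm F V) (w : V) : AddChar V ℂ :=
  ψ.compAddMonoidHom (Q.polarBilin.flip w).toAddMonoidHom

omit [Fintype F] [DecidableEq F] [Fintype V] in
theorem polarAddChar_apply (Q : QuadraticForm F V) (w x : V) :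
    polarAddChar ψ Q w x = ψ (QuadraticMap.polar Q x w) := rfl

omit [DecidableEq F] in
theorem isOrthogonal_polarAddChar (hψ : ψ.IsPrimitive) (Q : QuadraticForm F V)
    (hQ : Q.radical = ⊥) (hV : Even (Module.finrank F V)) :
    IsOrthogonal (polarAddChar ψ Q) where
  sum_apply _ hw := sum_addChar_polar hψ Q hQ hV hw
  sum_index x hx := by
    simp only [polarAddChar_apply, QuadraticMap.polar_comm Q x]
    exact sum_addChar_polar hψ Q hQ hV hx
  zero_apply x := by simp [polarAddChar_apply]
  index_zero w := by simp

/-- Invariance under scaling by `-1` turns one factor into the sum for `-Q`; after a shift,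
orthogonality leaves only the difference `0`. -/
theorem sum_addChar_quadraticForm_sq (hψ : ψ.IsPrimitive) (Q : QuadraticForm F V)
    (hQ : Q.radical = ⊥) (hV : Even (Module.finrank F V)) :
    (∑ x, ψ (Q x)) ^ 2 = Fintype.card V := by
  classical
  have h1 : (∑ x, ψ (Q x)) ^ 2 = ∑ y, ∑ z, ψ (Q z) * ψ (QuadraticMap.polar Q y z) := by
    rw [sq]
    nth_rewrite 2 [← sum_addChar_quadraticForm hψ Q hQ hV (neg_ne_zero.2 one_ne_zero)]
    rw [mul_comm, Finset.sum_mul]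
    refine Finset.sum_congr rfl fun y _ => ?_
    rw [Finset.mul_sum]
    refine (Fintype.sum_equiv (Equiv.addLeft y) _ _ fun z => ?_).symm
    rw [← AddChar.map_add_eq_mul, ← AddChar.map_add_eq_mul]
    congr 1
    simp only [Equiv.coe_addLeft, QuadraticMap.polar]
    ring
  rw [h1, Finset.sum_comm, Finset.sum_eq_single 0]
  · simp
  · intro z _ hz
    rw [← Finset.mul_sum, sum_addChar_polar hψ Q hQ hV hz, mul_zero]
  · simp

/-- The number of vectors at which a quadratic form takes the value `c`. -/
theorem card_mul_card_fiber (hψ : ψ.IsPrimitive) (Q : QuadraticForm F V)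
    (hQ : Q.radical = ⊥) (hV : Even (Module.finrank F V)) (c : F) :
    (Fintype.card F : ℂ) * Finset.card {x | Q x = c} =
      Fintype.card V + (∑ x, ψ (Q x)) * ((if c = 0 then (Fintype.card F : ℂ) else 0) - 1) := by
  have h1 : (Fintype.card F : ℂ) * Finset.card {x | Q x = c} =
      ∑ t, ∑ x, ψ (t * Q x) * ψ (t * -c) := by
    rw [Finset.sum_comm]
    simp_rw [← AddChar.map_add_eq_mul, ← mul_add, sum_addChar_mul hψ, ← sub_eq_add_neg,
      sub_eq_zero]
    rw [← Finset.sum_filter, Finset.sum_const, nsmul_eq_mul, mul_comm]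
  have h2 : ∑ t ∈ Finset.univ.erase (0 : F), ∑ x, ψ (t * Q x) * ψ (t * -c) =
      (∑ x, ψ (Q x)) * ∑ t ∈ Finset.univ.erase (0 : F), ψ (t * -c) := by
    rw [Finset.mul_sum]
    refine Finset.sum_congr rfl fun t ht => ?_
    rw [← Finset.sum_mul, sum_addChar_quadraticForm hψ Q hQ hV (Finset.ne_of_mem_erase ht)]
  have h3 := sum_addChar_mul hψ (-c)
  rw [← Finset.add_sum_erase _ _ (Finset.mem_univ (0 : F))] at h3
  simp only [zero_mul, AddChar.map_zero_eq_one, neg_eq_zero] at h3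
  rw [h1, ← Finset.add_sum_erase _ _ (Finset.mem_univ (0 : F)), h2, ← h3]
  simp

/-- An empty fibre would force `S = S ^ 2 = |V|` for the exponential sum `S`, so `|V|` would be `0`
or `1`. -/
theorem exists_quadraticForm_eq (Q : QuadraticForm F V)
    (hQ : Q.radical = ⊥) (hV : Even (Module.finrank F V)) [Nontrivial V] {c : F} (hc : c ≠ 0) :
    ∃ x, Q x = c := by
  classical
  by_contra! h
  have hψ := AddChar.FiniteField.primitiveChar_to_Complex_isPrimitive F
  have h1 := card_mul_card_fiber hψ Q hQ hV c
  have h2 := sum_addChar_quadraticForm_sq hψ Q hQ hV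
  have h0 : Finset.card {x | Q x = c} = 0 := by simp [h]
  rw [h0, if_neg hc, ← h2] at h1
  set S := ∑ x, AddChar.FiniteField.primitiveChar_to_Complex F (Q x)
  have hcard : (1 : ℕ) < Fintype.card V := Fintype.one_lt_card
  have h3 : S * (S - 1) = 0 := by
    push_cast at h1
    linear_combination -h1
  rcases mul_eq_zero.1 h3 with h4 | h4
  · rw [h4] at h2
    have : Fintype.card V = 0 := by
      have := h2.symm
      norm_num at this
    omega
  · rw [sub_eq_zero.1 h4, one_pow] at h2
    have : Fintype.card V = 1 := by exact_mod_cast h2.symm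
    omega

/-- A nonsingular quadratic form in at least four, and an even number of, variables over a finite
field is isotropic. -/
theorem exists_isotropic (Q : QuadraticForm F V) (hQ : Q.radical = ⊥) {m : ℕ}
    (hV : Module.finrank F V = 2 * m) (hm : 2 ≤ m) : ∃ x, x ≠ 0 ∧ Q x = 0 := by
  classical
  by_contra! h
  have hψ := AddChar.FiniteField.primitiveChar_to_Complex_isPrimitive F
  have hev : Even (Module.finrank F V) := by rw [hV]; exact even_two_mul m
  have h1 := card_mul_card_fiber hψ Q hQ hev 0
  have h2 := sum_addChar_quadraticForm_sq hψ Q hQ hev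
  have h0 : Finset.card {x | Q x = 0} = 1 := by
    rw [Finset.card_eq_one]
    refine ⟨0, ?_⟩
    ext x
    simp only [Finset.mem_filter, Finset.mem_univ, true_and, Finset.mem_singleton]
    refine ⟨fun hx => ?_, fun hx => by simp [hx]⟩
    by_contra hx0
    exact h x hx0 hx
  have hcV : Fintype.card V = (Fintype.card F ^ m) ^ 2 := by
    rw [Module.card_eq_pow_finrank (K := F) (V := V), hV, ← pow_mul, mul_comm]
  rw [h0, if_pos rfl, hcV] at h1
  rw [hcV] at h2
  set S := ∑ x, AddChar.FiniteField.primitiveChar_to_Complex F (Q x)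
  have hq : 1 < Fintype.card F := Fintype.one_lt_card
  obtain ⟨k, rfl⟩ := Nat.exists_eq_add_of_le hm
  set q := Fintype.card F
  -- Here `S = ±q ^ m`. With `0` as the only zero, `q = q ^ (2 m) ± q ^ m (q - 1)`, whose right side
  -- is divisible by `q ^ 2`.
  have hdvd : ((q : ℤ) ^ 2) ∣ q := by
    push_cast at h1 h2
    rcases sq_eq_sq_iff_eq_or_eq_neg.1 h2 with h3 | h3
    · rw [h3] at h1
      have h4 : (q : ℤ) = ((q : ℤ) ^ (2 + k)) ^ 2 + (q : ℤ) ^ (2 + k) * (q - 1) := by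
        have : (q : ℂ) = ((q : ℂ) ^ (2 + k)) ^ 2 + (q : ℂ) ^ (2 + k) * (q - 1) := by
          linear_combination h1
        exact_mod_cast this
      refine ⟨(q : ℤ) ^ k * (q : ℤ) ^ (2 + k) + (q : ℤ) ^ k * (q - 1), h4.trans ?_⟩
      ring
    · rw [h3] at h1
      have h4 : (q : ℤ) = ((q : ℤ) ^ (2 + k)) ^ 2 - (q : ℤ) ^ (2 + k) * (q - 1) := by
        have : (q : ℂ) = ((q : ℂ) ^ (2 + k)) ^ 2 - (q : ℂ) ^ (2 + k) * (q - 1) := by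
          linear_combination h1
        exact_mod_cast this
      refine ⟨(q : ℤ) ^ k * (q : ℤ) ^ (2 + k) - (q : ℤ) ^ k * (q - 1), h4.trans ?_⟩
      ring
  have hdvd' : q ^ 2 ∣ q := by exact_mod_cast hdvd
  have := Nat.le_of_dvd (by omega) hdvd'
  nlinarith

end ExponentialSums

/-! ### Cyclotomic classes as fibres of the `f`-th power map -/

section CyclotomicClass

variable {F : Type*} [Field F] [Fintype F] {g : Fˣ} {e f : ℕ}

theorem orderOf_primitive (hg : ∀ x : Fˣ, x ∈ Subgroup.zpowers g)
    (hef : e * f + 1 = Fintype.card F) : orderOf g = e * f := by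
  classical
  rw [orderOf_eq_card_of_forall_mem_zpowers hg, Nat.card_eq_fintype_card, Fintype.card_units,
    ← hef, Nat.add_sub_cancel]

theorem exists_pow_primitive (hg : ∀ x : Fˣ, x ∈ Subgroup.zpowers g) {y : F} (hy : y ≠ 0) :
    ∃ n : ℕ, (g : F) ^ n = y := by
  obtain ⟨n, hn⟩ := (mem_powers_iff_mem_zpowers.2 (hg (Units.mk0 y hy)))
  exact ⟨n, by simpa using congrArg Units.val hn⟩

theorem primitive_pow_eq_one_iff (hg : ∀ x : Fˣ, x ∈ Subgroup.zpowers g)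
    (hef : e * f + 1 = Fintype.card F) (n : ℕ) : (g : F) ^ n = 1 ↔ e * f ∣ n := by
  rw [← orderOf_primitive hg hef, orderOf_dvd_iff_pow_eq_one, Units.ext_iff,
    Units.val_pow_eq_pow_val, Units.val_one]

theorem pos_of_mul_add_one_eq_card (hef : e * f + 1 = Fintype.card F) : 0 < e ∧ 0 < f := by
  have := Fintype.one_lt_card (α := F)
  exact ⟨Nat.pos_of_ne_zero (by rintro rfl; omega), Nat.pos_of_ne_zero (by rintro rfl; omega)⟩

/-- The kernel of `y ↦ y ^ f` on units is generated by `g ^ e`, so the `f`-th power separates its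
cosets. This form links the classes to the periods. -/
theorem mem_cyclotomicClass_iff (hg : ∀ x : Fˣ, x ∈ Subgroup.zpowers g)
    (hef : e * f + 1 = Fintype.card F) (i : ℕ) (y : F) :
    y ∈ cyclotomicClass g e i ↔ y ^ f = ((g : F) ^ i) ^ f := by
  obtain ⟨he, hf⟩ := pos_of_mul_add_one_eq_card hef
  have hq : (Nat.card F - 1) / e = f := by
    rw [Nat.card_eq_fintype_card, ← hef, Nat.add_sub_cancel, Nat.mul_div_cancel_left _ he]
  have hgi : (g : F) ^ i ≠ 0 := pow_ne_zero _ g.ne_zero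
  have h1 : (g : F) ^ (e * f) = 1 := (primitive_pow_eq_one_iff hg hef _).2 dvd_rfl
  simp only [cyclotomicClass, hq, Set.mem_ofPred_eq]
  constructor
  · rintro ⟨l, -, rfl⟩
    rw [pow_add, mul_pow, ← pow_mul _ (e * l), mul_right_comm, pow_mul _ (e * f), h1, one_pow,
      mul_one]
  · intro h
    have hy : y ≠ 0 := by
      rintro rfl
      rw [zero_pow hf.ne'] at h
      exact pow_ne_zero _ hgi h.symm
    obtain ⟨n, hn⟩ := exists_pow_primitive hg (div_ne_zero hy hgi)
    have h2 : (g : F) ^ (n * f) = 1 := by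
      rw [pow_mul, hn, div_pow, h, div_self (pow_ne_zero _ hgi)]
    rw [primitive_pow_eq_one_iff hg hef] at h2
    obtain ⟨l, rfl⟩ := Nat.dvd_of_mul_dvd_mul_right hf h2
    refine ⟨l % f, Nat.mod_lt _ hf, ?_⟩
    have h3 : (g : F) ^ (e * l) = (g : F) ^ (e * (l % f)) := by
      conv_lhs => rw [← Nat.div_add_mod l f, mul_add, ← mul_assoc, pow_add, pow_mul, h1, one_pow,
        one_mul]
    rw [pow_add, ← h3, hn, mul_div_cancel₀ _ hgi]

theorem primitive_pow_pow_injective (hg : ∀ x : Fˣ, x ∈ Subgroup.zpowers g)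
    (hef : e * f + 1 = Fintype.card F) {i j : Fin e}
    (h : ((g : F) ^ (i : ℕ)) ^ f = ((g : F) ^ (j : ℕ)) ^ f) : i = j := by
  obtain ⟨he, hf⟩ := pos_of_mul_add_one_eq_card hef
  rw [← pow_mul, ← pow_mul] at h
  have h1 : g ^ ((i : ℕ) * f) = g ^ ((j : ℕ) * f) := by
    ext
    simpa using h
  have hlt : ∀ k : Fin e, (k : ℕ) * f < orderOf g := fun k => by
    rw [orderOf_primitive hg hef]
    exact Nat.mul_lt_mul_of_pos_right k.2 hf
  exact Fin.ext (Nat.eq_of_mul_eq_mul_right hf (pow_injOn_Iio_orderOf (hlt i) (hlt j) h1))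

theorem exists_mem_cyclotomicClass (hg : ∀ x : Fˣ, x ∈ Subgroup.zpowers g)
    (hef : e * f + 1 = Fintype.card F) {y : F} (hy : y ≠ 0) :
    ∃ i : Fin e, y ∈ cyclotomicClass g e i := by
  obtain ⟨he, hf⟩ := pos_of_mul_add_one_eq_card hef
  obtain ⟨n, rfl⟩ := exists_pow_primitive hg hy
  refine ⟨⟨n % e, Nat.mod_lt _ he⟩, (mem_cyclotomicClass_iff hg hef _ _).2 ?_⟩
  have h1 : (g : F) ^ (e * f) = 1 := (primitive_pow_eq_one_iff hg hef _).2 dvd_rfl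
  change ((g : F) ^ n) ^ f = ((g : F) ^ (n % e)) ^ f
  conv_lhs => rw [← Nat.div_add_mod n e]
  rw [pow_add, mul_pow, ← pow_mul, mul_right_comm, pow_mul, h1, one_pow, one_mul]

theorem eq_of_mem_cyclotomicClass (hg : ∀ x : Fˣ, x ∈ Subgroup.zpowers g)
    (hef : e * f + 1 = Fintype.card F) {i j : Fin e} {y : F} (hi : y ∈ cyclotomicClass g e i)
    (hj : y ∈ cyclotomicClass g e j) : i = j := by
  rw [mem_cyclotomicClass_iff hg hef] at hi hj
  exact primitive_pow_pow_injective hg hef (hi.symm.trans hj)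

theorem zero_notMem_cyclotomicClass (hg : ∀ x : Fˣ, x ∈ Subgroup.zpowers g)
    (hef : e * f + 1 = Fintype.card F) (i : ℕ) : (0 : F) ∉ cyclotomicClass g e i := by
  rw [mem_cyclotomicClass_iff hg hef, zero_pow (pos_of_mul_add_one_eq_card hef).2.ne']
  exact (pow_ne_zero _ (pow_ne_zero _ g.ne_zero)).symm

end CyclotomicClass

/-! ### Duality of the classes -/

section Transform

variable {V : Type*} [AddCommGroup V] [Fintype V]

open Classical in
/-- The form of `formAmorphicAssociationScheme_of_transform` in which the shifted transforms are
`M` times the indicator functions of disjoint predicates. -/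
theorem formAmorphicAssociationScheme_of_dual {d : ℕ} (A : Fin d → Set V)
    (hne : ∀ i, (A i).Nonempty) (hdisj : ∀ i j x, x ∈ A i → x ∈ A j → i = j)
    (hzero : ∀ i, (0 : V) ∉ A i) (hcover : ∀ x, x ≠ 0 → ∃ i, x ∈ A i)
    (hneg : ∀ i x, x ∈ A i → -x ∈ A i)
    {χ : V → AddChar V ℂ} (hχ : IsOrthogonal χ) (ρ : Fin d → ℂ) (M : ℂ) (P : Fin d → V → Prop)
    (hP : ∀ i j w, P i w → P j w → i = j)
    (h : ∀ w, w ≠ 0 → ∀ i, ∑ x, (if x ∈ A i then 1 else 0) * χ w x + ρ i =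
      M * if P i w then 1 else 0) :
    FormAmorphicAssociationScheme (fun i => cayleyEdges (A i)) := by
  refine formAmorphicAssociationScheme_of_transform A hne hdisj hzero hcover hneg hχ ρ M ?_
  intro w hw i j
  rw [h w hw, h w hw]
  by_cases hij : i = j
  · subst hij
    rw [if_pos rfl]
    split_ifs <;> ring
  · rw [if_neg hij]
    by_cases hi : P i w
    · rw [if_neg (fun hj => hij (hP i j w hi hj)), mul_zero, mul_zero]
    · rw [if_neg hi, mul_zero, zero_mul]

variable {F : Type*} [Field F] [Fintype F] [Module F V] {ψ : AddChar F ℂ} {g : Fˣ} {e f : ℕ}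

omit [Fintype V] [Fintype F] in
theorem quadraticForm_add_smul (Q : QuadraticForm F V) (x w : V) (s : F) :
    Q (x + s • w) = Q x + s ^ 2 * Q w + s * QuadraticMap.polar Q x w := by
  have h1 := QuadraticMap.polar_smul_right (Q := Q) s x w
  rw [QuadraticMap.polar, QuadraticMap.map_smul, smul_eq_mul, smul_eq_mul] at h1
  linear_combination h1

open Classical in
theorem transform_cyclotomicClass (hψ : ψ.IsPrimitive) (Q : QuadraticForm F V)
    (hQ : Q.radical = ⊥) (hV : Even (Module.finrank F V))
    (hg : ∀ x : Fˣ, x ∈ Subgroup.zpowers g) (hef : e * f + 1 = Fintype.card F) {r δ : ℂ}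
    (hr : r ^ 2 = Fintype.card F) (hδ : δ ^ 2 = 1) (hneg : (-1 : F) ^ f = 1)
    (hper : HasUniformPeriods ψ e f r δ) {w : V} (hw : w ≠ 0) (i : ℕ) :
    ∑ x, (if x ∈ {x | Q x ∈ cyclotomicClass g e i} then 1 else 0) * polarAddChar ψ Q w x +
        (∑ x, ψ (Q x)) * (Fintype.card F - 1) / (Fintype.card F * e) =
      (∑ x, ψ (Q x)) * if ((g : F) ^ i * Q w) ^ f = 1 then 1 else 0 := by
  have main := card_mul_sum_cyclotomic hψ (quadraticForm_add_smul Q)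
    (fun t ht => sum_addChar_quadraticForm hψ Q hQ hV ht) (sum_addChar_polar hψ Q hQ hV hw)
    hef hr hδ hneg hper (pow_ne_zero i g.ne_zero)
  simp only [Set.mem_ofPred_eq, mem_cyclotomicClass_iff hg hef, polarAddChar_apply]
  have hq : (Fintype.card F : ℂ) ≠ 0 := by exact_mod_cast Fintype.card_ne_zero
  have he : (e : ℂ) ≠ 0 := by
    exact_mod_cast (pos_of_mul_add_one_eq_card hef).1.ne'
  field_simp
  linear_combination main

open Classical in
-- The summand `1` in the shift restores the deleted vector `0`, at which every character is `1`.
theorem transform_isotropic (hψ : ψ.IsPrimitive) (Q : QuadraticForm F V)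
    (hQ : Q.radical = ⊥) (hV : Even (Module.finrank F V)) {w : V} (hw : w ≠ 0) :
    ∑ x, (if x ∈ {x | Q x = 0} \ {0} then 1 else 0) * polarAddChar ψ Q w x +
        (1 + (∑ x, ψ (Q x)) / Fintype.card F) =
      (∑ x, ψ (Q x)) * if Q w = 0 then 1 else 0 := by
  have main := card_mul_sum_fiber_zero hψ (quadraticForm_add_smul Q)
    (fun t ht => sum_addChar_quadraticForm hψ Q hQ hV ht) (sum_addChar_polar hψ Q hQ hV hw)
  have hq : (Fintype.card F : ℂ) ≠ 0 := by exact_mod_cast Fintype.card_ne_zero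
  have h1 : ∑ x, (if x ∈ {x | Q x = 0} \ {0} then (1 : ℂ) else 0) * polarAddChar ψ Q w x + 1 =
      ∑ x, (if Q x = 0 then 1 else 0) * ψ (QuadraticMap.polar Q x w) := by
    rw [← Finset.add_sum_erase _ _ (Finset.mem_univ (0 : V)),
      ← Finset.add_sum_erase (a := (0 : V)) _
        (fun x => (if Q x = 0 then (1 : ℂ) else 0) * ψ (QuadraticMap.polar Q x w))
        (Finset.mem_univ (0 : V))]
    have h2 : ∀ x ∈ Finset.univ.erase (0 : V),
        (if x ∈ {x | Q x = 0} \ {0} then (1 : ℂ) else 0) * polarAddChar ψ Q w x =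
          (if Q x = 0 then 1 else 0) * ψ (QuadraticMap.polar Q x w) := by
      intro x hx
      have hx0 : x ≠ 0 := Finset.ne_of_mem_erase hx
      simp [hx0, polarAddChar_apply]
    rw [Finset.sum_congr rfl h2]
    simp [add_comm]
  rw [← add_assoc, h1]
  have h3 : (if Q w = 0 then (Fintype.card F : ℂ) else 0) =
      Fintype.card F * if Q w = 0 then 1 else 0 := by simp
  rw [h3] at main
  refine mul_left_cancel₀ hq ?_
  rw [mul_add, main]
  field_simp
  ring

end Transform

end QuadraticCyclotomy

open QuadraticCyclotomy

/-! ### Assembly of the scheme -/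

theorem corollary2p4 {F : Type*} [Field F] [Finite F]
    (p e j γ m : ℕ) (hp : p.Prime) (he : 2 ≤ e) (hγ : 1 ≤ γ) (hm : 1 ≤ m)
    (hj : IsLeast {k : ℕ | 0 < k ∧ e ∣ p ^ k + 1} j)
    (hq : Nat.card F = p ^ (2 * j * γ))
    (g : Fˣ) (hg : ∀ x : Fˣ, x ∈ Subgroup.zpowers g)
    (Q : QuadraticForm F (Fin (2 * m) → F)) (hQ : Q.radical = ⊥) :
    (¬ (m = 1 ∧ Q.Anisotropic) →
      QuadraticCyclotomy.FormAmorphicAssociationScheme (d := e + 1)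
        (Fin.cons (α := fun _ => Set ((Fin (2 * m) → F) × (Fin (2 * m) → F)))
          (QuadraticCyclotomy.cayleyEdges ({x | Q x = 0} \ {0}))
          (fun i : Fin e => QuadraticCyclotomy.cayleyEdges
            {x | Q x ∈ QuadraticCyclotomy.cyclotomicClass g e i}))) ∧
    (m = 1 ∧ Q.Anisotropic →
      QuadraticCyclotomy.FormAmorphicAssociationScheme (d := e)
        (fun i : Fin e => QuadraticCyclotomy.cayleyEdges
          {x | Q x ∈ QuadraticCyclotomy.cyclotomicClass g e i})) := by
  classical
  let _ : Fintype F := Fintype.ofFinite F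
  obtain ⟨hj0, hdvd⟩ := hj.1
  have hcard : Fintype.card F = p ^ (2 * j * γ) := by rw [← Nat.card_eq_fintype_card, hq]
  obtain ⟨f, hf⟩ := dvd_pow_sub_one_of_dvd_pow_add_one hdvd γ
  have hef : e * f + 1 = Fintype.card F := by
    have : 0 < p ^ (2 * j * γ) := pow_pos hp.pos _
    omega
  obtain ⟨ψ, δ, hψ, hδ, hper⟩ :=
    exists_hasUniformPeriods hp hj0.ne' hdvd γ (by omega) F f hcard hef
  have hneg := neg_one_pow_eq_one_of_dvd hp hdvd hcard hef
  have hr : ((p ^ (j * γ) : ℕ) : ℂ) ^ 2 = Fintype.card F := by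
    rw [hcard]
    push_cast
    rw [← pow_mul]
    ring_nf
  have hfr : Module.finrank F (Fin (2 * m) → F) = 2 * m := by simp
  have hV : Even (Module.finrank F (Fin (2 * m) → F)) := by
    rw [hfr]
    exact even_two_mul m
  have : Nonempty (Fin (2 * m)) := ⟨⟨0, by omega⟩⟩
  have hχ := isOrthogonal_polarAddChar hψ Q hQ hV
  set M := ∑ x, ψ (Q x)
  let A : Fin e → Set (Fin (2 * m) → F) := fun i => {x | Q x ∈ cyclotomicClass g e i}
  have hAne : ∀ i, (A i).Nonempty := by
    intro i
    obtain ⟨x, hx⟩ := exists_quadraticForm_eq Q hQ hV (pow_ne_zero (i : ℕ) g.ne_zero)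
    refine ⟨x, ?_⟩
    change Q x ∈ cyclotomicClass g e i
    rw [mem_cyclotomicClass_iff hg hef, hx]
  have hA0 : ∀ i x, x ∈ A i → Q x ≠ 0 := by
    intro i x hx h0
    change Q x ∈ cyclotomicClass g e i at hx
    rw [h0] at hx
    exact zero_notMem_cyclotomicClass hg hef _ hx
  have hAdisj : ∀ i j x, x ∈ A i → x ∈ A j → i = j := fun i j x hi hj =>
    eq_of_mem_cyclotomicClass hg hef hi hj
  have hAcover : ∀ x, Q x ≠ 0 → ∃ i, x ∈ A i := fun x hx =>
    exists_mem_cyclotomicClass hg hef hx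
  have hAneg : ∀ i x, x ∈ A i → -x ∈ A i := by
    intro i x hx
    change Q (-x) ∈ cyclotomicClass g e i
    rwa [QuadraticMap.map_neg]
  -- The dual of class `i` consists of the `w` with `Q w` in the inverse class.
  let P : Fin e → (Fin (2 * m) → F) → Prop := fun i w => ((g : F) ^ (i : ℕ) * Q w) ^ f = 1
  have hf0 : f ≠ 0 := (pos_of_mul_add_one_eq_card hef).2.ne'
  have hP0 : ∀ i w, P i w → Q w ≠ 0 := by
    intro i w hi h0
    simp only [P, h0, mul_zero, zero_pow hf0] at hi
    exact zero_ne_one hi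
  have hPdisj : ∀ i j w, P i w → P j w → i = j := by
    intro i j w hi hj
    refine primitive_pow_pow_injective hg hef
      (mul_right_cancel₀ (pow_ne_zero f (hP0 i w hi)) ?_)
    rw [← mul_pow, ← mul_pow]
    exact hi.trans hj.symm
  have hT := fun w hw (i : Fin e) =>
    transform_cyclotomicClass hψ Q hQ hV hg hef hr hδ hneg hper (w := w) hw (i : ℕ)
  refine ⟨fun hcase => ?_, fun ⟨_, haniso⟩ => ?_⟩
  -- A nonzero isotropic vector makes the extra class nonempty; the excluded case is exactly where
  -- there is none.
  · obtain ⟨x₀, hx₀, hQx₀⟩ : ∃ x, x ≠ 0 ∧ Q x = 0 := by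
      by_cases haniso : Q.Anisotropic
      · exact exists_isotropic Q hQ hfr (by
          have : m ≠ 1 := fun h => hcase ⟨h, haniso⟩
          omega)
      · unfold QuadraticMap.Anisotropic at haniso
        push Not at haniso
        obtain ⟨x, h1, h2⟩ := haniso
        exact ⟨x, h2, h1⟩
    let A' : Fin (e + 1) → Set (Fin (2 * m) → F) := Fin.cons ({x | Q x = 0} \ {0}) A
    let P' : Fin (e + 1) → (Fin (2 * m) → F) → Prop := Fin.cons (fun w => Q w = 0) P
    have hG : (Fin.cons (α := fun _ => Set ((Fin (2 * m) → F) × (Fin (2 * m) → F)))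
        (cayleyEdges ({x | Q x = 0} \ {0})) (fun i : Fin e => cayleyEdges (A i))) =
        fun i => cayleyEdges (A' i) := by
      funext i
      refine Fin.cases rfl (fun i => rfl) i
    change FormAmorphicAssociationScheme (Fin.cons
      (α := fun _ => Set ((Fin (2 * m) → F) × (Fin (2 * m) → F)))
        (cayleyEdges ({x | Q x = 0} \ {0})) (fun i : Fin e => cayleyEdges (A i)))
    rw [hG]
    refine formAmorphicAssociationScheme_of_dual A' ?_ ?_ ?_ ?_ ?_ hχ
      (Fin.cons (1 + M / Fintype.card F)
        fun _ => M * (Fintype.card F - 1) / (Fintype.card F * e)) M P' ?_ ?_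
    · exact Fin.cases ⟨x₀, hQx₀, hx₀⟩ hAne
    · intro i j x
      refine Fin.cases ?_ (fun i => ?_) i <;> refine Fin.cases ?_ (fun j => ?_) j
      · intro _ _
        rfl
      · intro h1 h2
        exact absurd h1.1 (hA0 j x h2)
      · intro h1 h2
        exact absurd h2.1 (hA0 i x h1)
      · intro h1 h2
        rw [hAdisj i j x h1 h2]
    · refine Fin.cases (fun h => h.2 rfl) (fun i h => hA0 i 0 h (QuadraticMap.map_zero Q))
    · intro x hx
      by_cases hQx : Q x = 0
      · exact ⟨0, hQx, hx⟩
      · obtain ⟨i, hi⟩ := hAcover x hQx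
        exact ⟨i.succ, hi⟩
    · refine Fin.cases (fun x hx => ?_) hAneg
      refine ⟨?_, fun h => hx.2 (neg_eq_zero.1 h)⟩
      change Q (-x) = 0
      rw [QuadraticMap.map_neg]
      exact hx.1
    · intro i j w
      refine Fin.cases ?_ (fun i => ?_) i <;> refine Fin.cases ?_ (fun j => ?_) j
      · intro _ _
        rfl
      · intro h1 h2
        exact absurd h1 (hP0 j w h2)
      · intro h1 h2
        exact absurd h2 (hP0 i w h1)
      · intro h1 h2
        rw [hPdisj i j w h1 h2]
    · intro w hw i
      refine Fin.cases ?_ (fun i => ?_) i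
      -- The two sums differ only in their decidability instances.
      · refine Eq.trans (congrArg₂ (· + ·) (Finset.sum_congr rfl fun x _ => ?_) rfl)
          (transform_isotropic hψ Q hQ hV hw)
        congr 1
        by_cases h : x ∈ A' 0
        · rw [if_pos h]
          exact (if_pos h).symm
        · rw [if_neg h]
          exact (if_neg h).symm
      · exact hT w hw i
  · have hQ0 : ∀ x, x ≠ 0 → Q x ≠ 0 := fun x hx h => hx (haniso x h)
    exact formAmorphicAssociationScheme_of_dual A hAne hAdisj
      (fun i h => hA0 i 0 h (QuadraticMap.map_zero Q)) (fun x hx => hAcover x (hQ0 x hx)) hAneg hχ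
      (fun _ => M * (Fintype.card F - 1) / (Fintype.card F * e)) M P hPdisj hT
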